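/- **Setting.** Let $\mathcal S,\mathcal A,\mathcal F$ be sets (states, actions, reward feedback), $s_1\in\mathcal S$, $H\in\mathbb N$; $\Delta(X)$ denotes the discrete probability distributions on a set $X$. Let $\Pi$ be a finite non-empty set of policies $\pi:\mathcal S\to\Delta(\mathcal A)$ (deterministic policies being a special case) and $\mathcal P$ a finite set of transition kernels $P:\mathcal S\times\mathcal A\to\Delta(\mathcal S)$. An episode of $\pi$ under $P$ is a trajectory $\tau=(s_1,a_1,\dots,s_H,a_H)$ with $a_h\sim\pi(\cdot|s_h)$, $s_{h+1}\sim P(\cdot|s_h,a_h)$. An element $R$ of the reward space $\mathcal R$ consists of a reward function $R:\mathcal S\times\mathcal A\to[0,1]$ and of the conditional law $R(\cdot|\tau)\in\Delta(\mathcal F)$ of the reward feedback given the trajectory; under bandit feedback, the feedback is the list of realized rewards, whose conditional means are $R(s_h,a_h)$. Assume that $\sum_{h=1}^H R(s_h,a_h)\le 1$ almost surely for all $P\in\mathcal P$, $R\in\mathcal R$, $\pi\in\Pi$, and that $\mathcal R$ is convex, i.e. closed under mixtures $\lambda R+(1-\lambda)R'$, $\lambda\in[0,1]$ (of the reward functions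 and of the feedback laws simultaneously). A model $M=(P,R)\in\mathcal M=\mathcal P\times\mathcal R$ assigns to $\pi\in\Pi$ the law $M(\cdot|\pi)$ of the observation $o=(\tau,f)$, $f\sim R(\cdot|\tau)$, and the value $V_M(\pi)=\mathbb E[\sum_{h}R(s_h,a_h)]$. Let $\mathrm{co}(\mathcal M)$ be the set of finite mixtures $\bar M(\cdot|\pi)$ of the observation laws of models in $\mathcal M$, and for $\eta>0$ $$\mathsf{DEC}^{\mathrm{KL}}_\eta(\mathcal M)=\sup_{\bar M\in\mathrm{co}(\mathcal M)}\ \inf_{p\in\Delta(\Pi)}\ \sup_{M\in\mathcal M}\ \mathbb E_{\pi\sim p}\Big[\max_{\pi'\in\Pi}V_M(\pi')-V_M(\pi)-\tfrac1\eta D_{\mathrm{KL}}\big(M(\cdot|\pi),\bar M(\cdot|\pi)\big)\Big].$$ **Hybrid problem.** The environment fixes $P^\star\in\mathcal P$ and a comparator $\pi^\star\in\Pi$, unknown to the learner. In each round $t=1,\dots,T$ an adversary picks $R_t\in\mathcal R$, possibly at random and depending on everything that happened in rounds $1,\dots,t-1$; the learner, knowing only $(\pi_i,o_i)_{i<t}$,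 picks $\pi_t\in\Pi$, possibly at random; then $o_t\sim M_t(\cdot|\pi_t)$ is observed, where $M_t=(P^\star,R_t)$. The regret is $\mathrm{Reg}(\pi^\star)=\sum_{t=1}^T\big(V_{M_t}(\pi^\star)-V_{M_t}(\pi_t)\big)$. **Corollary.** For all $T\in\mathbb N$ and $\eta>0$ there is an algorithm for the learner such that, for every $P^\star\in\mathcal P$, every $\pi^\star\in\Pi$ and every adversary, $$\mathbb E[\mathrm{Reg}(\pi^\star)]\le\frac{\log(|\Pi||\mathcal P|)}{\eta}+T\cdot\mathsf{DEC}^{\mathrm{KL}}_\eta(\mathcal M).$$ -/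

import Mathlib

open scoped ENNReal NNReal

noncomputable section

namespace HybridDEC

/-! ### General decision making -/

/-- A model of a decision making problem with policies `Pol` and observations `O`: the law
`M(· | π)` of the observation and the expected reward `V_M(π)` of every policy `π`. -/
structure Model (Pol O : Type*) where
  law : Pol → PMF O
  value : Pol → ℝ

/-- Kullback–Leibler divergence of two discrete distributions (all sets are measurable). -/
def kl {O : Type*} (p q : PMF O) : ℝ≥0∞ :=
  letI : MeasurableSpace O := ⊤
  InformationTheory.klDiv p.toMeasure q.toMeasure

/-- `co(𝓜)`: all finite mixtures of (the observation laws of) models in `𝓜`. -/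
def co {Pol O : Type*} (𝓜 : Set (Model Pol O)) : Set (Pol → PMF O) :=
  {Mbar | ∃ μ : PMF (Model Pol O), μ.support.Finite ∧ μ.support ⊆ 𝓜 ∧
    ∀ π, Mbar π = μ.bind fun M => M.law π}

/-- `𝔼_{π ∼ p} [V_M(π_M) - V_M(π) - (1/η) KL(M(·|π), Mbar(·|π))]`, a number in `[-∞, ∞)`.
Here `V_M(π_M) = max_π V_M(π)`. -/
def decObjective {Pol O : Type*} [Fintype Pol] (η : ℝ) (Mbar : Pol → PMF O) (p : PMF Pol)
    (M : Model Pol O) : EReal :=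
  ((∑ π, (p π).toReal * ((⨆ π', M.value π') - M.value π) : ℝ) : EReal)
    - ((ENNReal.ofReal η⁻¹ * ∑ π, p π * kl (M.law π) (Mbar π) : ℝ≥0∞) : EReal)

/-- The offset decision-estimation coefficient with KL divergence. -/
def DEC {Pol O : Type*} [Fintype Pol] (η : ℝ) (𝓜 : Set (Model Pol O)) : EReal :=
  ⨆ Mbar ∈ co 𝓜, ⨅ p : PMF Pol, ⨆ M ∈ 𝓜, decObjective η Mbar p M

/-! ### Markov decision processes -/

/-- A transition kernel `P(· | s, a)`. -/
abbrev Transition (S A : Type*) := S → A → PMF S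

/-- A policy `π(· | s)`; a deterministic policy is one whose values are point masses. -/
abbrev Policy (S A : Type*) := S → PMF A

/-- A trajectory `(s₁, a₁), …, (s_H, a_H)`. -/
abbrev Traj (S A : Type*) := List (S × A)

/-- The reward component of a model: the reward function `R(s, a)`, and the conditional law of
the reward feedback which the learner receives in an episode, given the trajectory.
Bandit feedback is the case where the feedback is the list of the realized rewards
`r₁, …, r_H`, whose conditional means are the `R(s_h, a_h)`. -/
structure Reward (S A F : Type*) where
  mean : S → A → ℝ
  feedback : Traj S A → PMF F

/-- Convexity of a reward space: it is closed under mixtures of its elements. -/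
def ConvexRewards {S A F : Type*} (𝓡 : Set (Reward S A F)) : Prop :=
  ∀ R ∈ 𝓡, ∀ R' ∈ 𝓡, ∀ a b : ℝ≥0, a + b = 1 → ∃ R'' ∈ 𝓡,
    (∀ s x, R''.mean s x = a * R.mean s x + b * R'.mean s x) ∧
    (∀ τ f, R''.feedback τ f = a * R.feedback τ f + b * R'.feedback τ f)

/-- The law of the trajectory of `H` steps from state `s`. -/
def trajLaw {S A : Type*} (P : Transition S A) (π : Policy S A) : ℕ → S → PMF (Traj S A)
  | 0, _ => PMF.pure []
  | H + 1, s =>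
    (π s).bind fun a => (P s a).bind fun s' =>
      (trajLaw P π H s').map fun τ => (s, a) :: τ

/-- The cumulative reward `∑_h R(s_h, a_h)` along a trajectory. -/
def cumReward {S A F : Type*} (R : Reward S A F) (τ : Traj S A) : ℝ :=
  (τ.map fun x => R.mean x.1 x.2).sum

/-- An observation: the trajectory of the episode together with the reward feedback. -/
abbrev Obs (S A F : Type*) := Traj S A × F

/-- The model `M = (P, R)` on the policy class `Pol`, for episodes of `H` steps from `s₁`. -/
def mdp {S A F : Type*} (H : ℕ) (s₁ : S) (Pol : Finset (Policy S A)) (P : Transition S A)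
    (R : Reward S A F) : Model Pol (Obs S A F) where
  law π := (trajLaw P π.1 H s₁).bind fun τ => (R.feedback τ).map fun f => (τ, f)
  value π := ∑' τ, (trajLaw P π.1 H s₁ τ).toReal * cumReward R τ

/-- The model class `𝓜 = 𝓟 × 𝓡`. -/
def mdpClass {S A F : Type*} (H : ℕ) (s₁ : S) (Pol : Finset (Policy S A))
    (𝓟 : Finset (Transition S A)) (𝓡 : Set (Reward S A F)) : Set (Model Pol (Obs S A F)) :=
  {M | ∃ P ∈ 𝓟, ∃ R ∈ 𝓡, M = mdp H s₁ Pol P R}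

/-! ### The interaction with fixed transition and adversarial rewards -/

/-- A (randomized) algorithm chooses `π_t` from the past policies and observations. -/
abbrev Algorithm {S A : Type*} (F : Type*) (Pol : Finset (Policy S A)) :=
  List (Pol × Obs S A F) → PMF Pol

/-- What happens in one round: the reward `R_t`, the policy `π_t`, the observation `o_t`. -/
abbrev Round {S A F : Type*} (Pol : Finset (Policy S A)) (𝓡 : Set (Reward S A F)) :=
  𝓡 × Pol × Obs S A F

/-- A (randomized, adaptive) adversary chooses `R_t ∈ 𝓡` from the whole past. -/
abbrev Adversary {S A F : Type*} (Pol : Finset (Policy S A)) (𝓡 : Set (Reward S A F)) :=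
  List (Round Pol 𝓡) → PMF 𝓡

/-- The law of the first `t` rounds. In each round the adversary and the algorithm choose `R_t`
and `π_t`, independently given the past, and `o_t ∼ M_t(· | π_t)` with `M_t = (P, R_t)`. -/
def historyLaw {S A F : Type*} (H : ℕ) (s₁ : S) {Pol : Finset (Policy S A)}
    {𝓡 : Set (Reward S A F)} (P : Transition S A) (alg : Algorithm F Pol)
    (adv : Adversary Pol 𝓡) : ℕ → PMF (List (Round Pol 𝓡))
  | 0 => PMF.pure []
  | t + 1 =>
    (historyLaw H s₁ P alg adv t).bind fun h =>
      (adv h).bind fun R =>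
        (alg (h.map fun x => x.2)).bind fun π =>
          ((mdp H s₁ Pol P R.1).law π).map fun o => h ++ [(R, π, o)]

/-- The regret `∑_t (V_{M_t}(π⋆) - V_{M_t}(π_t))` of a history. -/
def regret {S A F : Type*} (H : ℕ) (s₁ : S) {Pol : Finset (Policy S A)}
    {𝓡 : Set (Reward S A F)} (P : Transition S A) (πstar : Pol) (h : List (Round Pol 𝓡)) : ℝ :=
  (h.map fun x => (mdp H s₁ Pol P x.1.1).value πstar - (mdp H s₁ Pol P x.1.1).value x.2.1).sum

/-- The expected regret `𝔼[Reg(π⋆)]` after `T` rounds. -/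
def expectedRegret {S A F : Type*} (H : ℕ) (s₁ : S) {Pol : Finset (Policy S A)}
    {𝓡 : Set (Reward S A F)} (P : Transition S A) (alg : Algorithm F Pol)
    (adv : Adversary Pol 𝓡) (πstar : Pol) (T : ℕ) : ℝ :=
  ∑' h, (historyLaw H s₁ P alg adv T h).toReal * regret H s₁ P πstar h

end HybridDEC

end

open scoped ENNReal NNReal

noncomputable section

namespace HybridDEC

open MeasureTheory

/-! ### Kullback–Leibler divergence of discrete distributions -/

/-! The learner keeps a belief `ρ` on pairs `φ = (π⋆, P⋆)`, uniform at the start, and charges its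
regret to the potential `-log ρ(φ) / η` at the true pair. It suffices to find, for every `ρ`, a
policy distribution and an update rule for the belief such that, for all `φ` and all rewards in `𝓡`,
the expected regret of the round plus the expected new potential is at most the DEC plus the old
potential. Over `T` rounds this telescopes: the last potential is nonnegative, the first is
`log(|Π||𝓟|) / η`. As the bound holds for every reward, an adaptive adversary gains nothing.

Such a strategy exists by a minimax argument. Against a finite mixture of pairs (parameter, model),
convexity of `𝓡` merges the models that share a parameter, leaving one model `M φ` per `φ` and a
prior `W`. The learner plays a distribution that nearly attains the DEC at the mixture `Mbar` and
updates to the Bayes posterior `W φ * M φ / Mbar`. Under `M φ` the log loss of the posterior has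
mean `-log W φ - KL(M φ, Mbar)`, and this KL term is the one that the DEC subtracts
(`exists_roundLoss_le_of_prior`). Gibbs' inequality then trades `-log W` for `-log ρ` on average
(`exists_sum_mul_roundLoss_le`).

The quantifiers are exchanged for finite families by separation (`exists_forall_lt_of_convexlike`)
and for all models by compactness of the strategy space (`exists_strategy`). The logarithm is
smoothed to make the loss bounded and continuous; monotone convergence removes the smoothing. -/

theorem toMeasure_eq_withDensity_div {O : Type*} [MeasurableSpace O]
    [DiscreteMeasurableSpace O] (p q : PMF O) (h : ∀ o, q o = 0 → p o = 0) :
    p.toMeasure = q.toMeasure.withDensity fun o => p o / q o := by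
  have key : ∀ o, p o / q o * q o = p o := fun o => by
    by_cases hq : q o = 0
    · simp [hq, h o hq]
    · exact ENNReal.div_mul_cancel hq (q.apply_ne_top o)
  ext s hs
  rw [withDensity_apply _ hs, ← lintegral_indicator hs, ← q.restrict_toMeasure_support,
    lintegral_countable _ q.support_countable, p.toMeasure_apply hs,
    tsum_subtype q.support fun o => s.indicator (fun o => p o / q o) o * q.toMeasure {o}]
  refine tsum_congr fun o => ?_
  have hqs := q.toMeasure_apply_singleton o (MeasurableSet.singleton o)
  by_cases hq : q o = 0
  · have : o ∉ q.support := by simpa [PMF.mem_support_iff] using hq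
    simp [Set.indicator, this, h o hq]
  · have : o ∈ q.support := by simpa [PMF.mem_support_iff] using hq
    by_cases hs : o ∈ s <;> simp [Set.indicator, this, hs, key, hqs]

/-- Cross-entropy bound: if `W p ≤ q` and the loss `g` is dominated by the logarithmic loss
of the posterior weight `W p / q`, then its mean is at most `-log W - KL(p, q)`. -/
theorem tsum_mul_le_neg_log_sub_kl {O : Type*} (p q : PMF O) {W : ℝ} (hW : 0 < W)
    (h : ∀ o, ENNReal.ofReal W * p o ≤ q o) (g : O → ℝ) (B : ℝ) (hg : ∀ o, |g o| ≤ B)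
    (hgl : ∀ o, p o ≠ 0 → g o ≤ -Real.log (W * ((p o).toReal / (q o).toReal))) :
    kl p q ≠ ∞ ∧ ∑' o, (p o).toReal * g o ≤ -Real.log W - (kl p q).toReal := by
  let : MeasurableSpace O := ⊤
  have hW0 : ENNReal.ofReal W ≠ 0 := by simpa using hW
  have hq0 : ∀ o, q o = 0 → p o = 0 := fun o ho => by
    have := h o
    rw [ho, nonpos_iff_eq_zero, mul_eq_zero] at this
    exact this.resolve_left hW0
  have hd := toMeasure_eq_withDensity_div p q hq0
  have hac : p.toMeasure ≪ q.toMeasure := by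
    rw [hd]; exact withDensity_absolutelyContinuous _ _
  have hrn : p.toMeasure.rnDeriv q.toMeasure =ᵐ[q.toMeasure] fun o => p o / q o := by
    conv_lhs => rw [hd]
    exact Measure.rnDeriv_withDensity _ (fun _ _ => trivial)
  -- The domination `W p ≤ q` bounds the density by `1 / W`; `klFun` is bounded on that interval, so
  -- the divergence is finite.
  have hbd : ∀ o, (p o / q o).toReal ≤ W⁻¹ := fun o => by
    refine ENNReal.toReal_le_of_le_ofReal (by positivity) ?_
    refine ENNReal.div_le_of_le_mul ?_
    rw [ENNReal.ofReal_inv_of_pos hW, mul_comm, ← div_eq_mul_inv]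
    rw [ENNReal.le_div_iff_mul_le (Or.inl hW0) (Or.inl ENNReal.ofReal_ne_top), mul_comm]
    exact h o
  have hfin : InformationTheory.klDiv p.toMeasure q.toMeasure ≠ ∞ := by
    rw [InformationTheory.klDiv_eq_lintegral_klFun_of_ac hac]
    obtain ⟨C, hC⟩ := (isCompact_Icc (a := (0 : ℝ)) (b := W⁻¹)).exists_bound_of_continuousOn
      InformationTheory.continuous_klFun.continuousOn
    refine ne_top_of_le_ne_top (b := ENNReal.ofReal C) ENNReal.ofReal_ne_top ?_
    calc _ ≤ ∫⁻ _, ENNReal.ofReal C ∂q.toMeasure := by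
            refine lintegral_mono_ae ?_
            filter_upwards [hrn] with o ho
            rw [ho]
            exact ENNReal.ofReal_le_ofReal ((le_abs_self _).trans
              (hC _ ⟨ENNReal.toReal_nonneg, hbd o⟩))
      _ = _ := by simp
  have hint := (InformationTheory.klDiv_ne_top_iff.1 hfin).2
  refine ⟨hfin, ?_⟩
  have hkl : (kl p q).toReal = ∫ o, llr p.toMeasure q.toMeasure o ∂p.toMeasure :=
    InformationTheory.toReal_klDiv_of_measure_eq hac (by simp)
  have hgi : Integrable g p.toMeasure :=
    Integrable.of_bound (Measurable.aestronglyMeasurable fun _ _ => trivial) B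
      (Filter.Eventually.of_forall hg)
  have h1 := p.integral_eq_tsum g hgi
  simp only [smul_eq_mul] at h1
  rw [← h1, hkl]
  have h2 : ∫ o, (-Real.log W - llr p.toMeasure q.toMeasure o) ∂p.toMeasure
      = -Real.log W - ∫ o, llr p.toMeasure q.toMeasure o ∂p.toMeasure := by
    rw [integral_sub (integrable_const _) hint]; simp
  rw [← h2]
  refine integral_mono_ae hgi ((integrable_const _).sub hint) ?_
  have hsupp : ∀ᵐ o ∂p.toMeasure, p o ≠ 0 := by
    rw [ae_iff, PMF.toMeasure_apply_eq_zero_iff _ (by trivial), Set.disjoint_left]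
    intro o ho; simpa [PMF.mem_support_iff] using ho
  filter_upwards [hac.ae_le hrn, hsupp] with o ho hp
  have hqo : q o ≠ 0 := fun hq => hp (hq0 o hq)
  have hp' : 0 < (p o).toReal := ENNReal.toReal_pos hp (p.apply_ne_top o)
  have hq' : 0 < (q o).toReal := ENNReal.toReal_pos hqo (q.apply_ne_top o)
  refine (hgl o hp).trans_eq ?_
  rw [llr, ho, ENNReal.toReal_div, Real.log_mul hW.ne' (div_pos hp' hq').ne']
  ring

theorem kl_self {O : Type*} (p : PMF O) : kl p p = 0 :=
  letI : MeasurableSpace O := ⊤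
  InformationTheory.klDiv_self p.toMeasure

/-! ### A minimax theorem for convexlike families -/

/-- If every convex combination of the `f i - C i` takes a negative value, then so do all of them
simultaneously, provided that the family `f` is convexlike. -/
theorem exists_forall_lt_of_convexlike {X ι : Type*} [Fintype ι] (s : Set X) (hs : s.Nonempty)
    (f : ι → X → ℝ) (C : ι → ℝ)
    (hf : ∀ x ∈ s, ∀ y ∈ s, ∀ a b : ℝ, 0 ≤ a → 0 ≤ b → a + b = 1 →
      ∃ z ∈ s, ∀ i, f i z ≤ a * f i x + b * f i y)
    (h : ∀ w ∈ stdSimplex ℝ ι, ∃ x ∈ s, ∑ i, w i * f i x < ∑ i, w i * C i) :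
    ∃ x ∈ s, ∀ i, f i x < C i := by
  classical
  -- `V` is open, convex and closed under increasing coordinates. If it missed `C`, a separating
  -- functional would give weights `w` contradicting `h`.
  let V : Set (ι → ℝ) := {v | ∃ x ∈ s, ∀ i, f i x < v i}
  suffices hV : C ∈ V from hV
  by_contra hCV
  have hopen : IsOpen V := by
    have : V = ⋃ x ∈ s, ⋂ i, {v : ι → ℝ | f i x < v i} := by
      ext v; simp [V]
    rw [this]
    exact isOpen_biUnion fun x _ => isOpen_iInter_of_finite fun i =>
      isOpen_lt continuous_const (continuous_apply i)
  have hconv : Convex ℝ V := by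
    rintro v ⟨x, hx, hxv⟩ v' ⟨y, hy, hyv⟩ a b ha hb hab
    obtain ⟨z, hz, hzf⟩ := hf x hx y hy a b ha hb hab
    refine ⟨z, hz, fun i => (hzf i).trans_lt ?_⟩
    simp only [Pi.add_apply, Pi.smul_apply, smul_eq_mul]
    rcases ha.eq_or_lt with rfl | ha
    · obtain rfl : b = 1 := by linarith
      simpa using hyv i
    · have := mul_lt_mul_of_pos_left (hxv i) ha
      have := mul_le_mul_of_nonneg_left (hyv i).le hb
      linarith
  obtain ⟨g, hg⟩ := geometric_hahn_banach_open_point hconv hopen hCV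
  let w : ι → ℝ := fun i => -g (Pi.single i 1)
  have hgw : ∀ v : ι → ℝ, g v = -∑ i, w i * v i := fun v => by
    conv_lhs => rw [pi_eq_sum_univ' v]
    simp only [map_sum, map_smul, smul_eq_mul, w, neg_mul, Finset.sum_neg_distrib, neg_neg]
    exact Finset.sum_congr rfl fun i _ => mul_comm _ _
  have hlt : ∀ x ∈ s, ∀ v : ι → ℝ, (∀ i, f i x < v i) → ∑ i, w i * C i < ∑ i, w i * v i := by
    intro x hx v hv
    have := hg v ⟨x, hx, hv⟩
    rw [hgw, hgw] at this
    linarith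
  obtain ⟨x₀, hx₀⟩ := hs
  have hw0 : ∀ i, 0 ≤ w i := fun i => by
    by_contra hi
    push Not at hi
    -- Raising coordinate `i` by `D / (-w i)` stays in `V` and lowers the weighted sum by `D`,
    -- exactly down to its value at `C`, which separation forbids.
    let D := ∑ j, w j * (f j x₀ + 1) - ∑ j, w j * C j
    have hD : 0 < D := sub_pos.2 (hlt x₀ hx₀ _ fun j => by linarith)
    have hk : 0 < D / (-w i) := div_pos hD (by linarith)
    have := hlt x₀ hx₀ (fun j => f j x₀ + 1 + (Pi.single i (D / (-w i)) : ι → ℝ) j) fun j => by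
      have : 0 ≤ (Pi.single i (D / (-w i)) : ι → ℝ) j := by
        by_cases hj : j = i
        · subst hj; simpa using hk.le
        · simp [hj]
      linarith
    simp only [mul_add, Finset.sum_add_distrib, Pi.single_apply, mul_ite, mul_zero,
      Finset.sum_ite_eq', Finset.mem_univ, if_true] at this
    have h3 : w i * (D / (-w i)) = -D := by
      rw [div_neg, mul_neg, mul_div_cancel₀ _ hi.ne]
    rw [h3] at this
    simp only [D, mul_add, Finset.sum_add_distrib] at this
    linarith
  have hpos : 0 < ∑ i, w i := by
    refine (Finset.sum_nonneg fun i _ => hw0 i).lt_of_ne' fun h0 => ?_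
    have hz : ∀ i, w i = 0 := fun i =>
      (Finset.sum_eq_zero_iff_of_nonneg fun i _ => hw0 i).1 h0 i (Finset.mem_univ i)
    have := hlt x₀ hx₀ (fun j => f j x₀ + 1) fun j => by linarith
    simp [hz] at this
  obtain ⟨x, hx, hxlt⟩ := h (fun i => w i / ∑ j, w j)
    ⟨fun i => div_nonneg (hw0 i) hpos.le, by rw [← Finset.sum_div, div_self hpos.ne']⟩
  simp only [div_mul_eq_mul_div, ← Finset.sum_div] at hxlt
  rw [div_lt_div_iff_of_pos_right hpos] at hxlt
  -- Spreading the slack evenly over the coordinates gives a point of `V` with the same weighted sum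
  -- as `C`.
  let D := (∑ i, w i * C i - ∑ i, w i * f i x) / ∑ i, w i
  have hD : 0 < D := div_pos (sub_pos.2 hxlt) hpos
  have := hlt x hx (fun i => f i x + D) fun i => by linarith
  simp only [mul_add, Finset.sum_add_distrib, ← Finset.sum_mul] at this
  rw [mul_div_cancel₀ _ hpos.ne'] at this
  linarith

section

/-! ### Smoothed logarithmic loss -/

/-- The logarithmic loss `-log u`, smoothed so that it is bounded on `[0, 1]`. -/
def smoothLog (δ u : ℝ) : ℝ := -Real.log ((1 - δ) * u + δ)

section smoothLog

variable {δ u : ℝ}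

theorem le_smoothing (hδ1 : δ < 1) (hu : 0 ≤ u) : δ ≤ (1 - δ) * u + δ := by nlinarith

theorem smoothing_le_one (hδ1 : δ < 1) (hu : u ≤ 1) : (1 - δ) * u + δ ≤ 1 := by nlinarith

theorem smoothLog_nonneg (hδ : 0 < δ) (hδ1 : δ < 1) (hu : 0 ≤ u) (hu1 : u ≤ 1) :
    0 ≤ smoothLog δ u :=
  neg_nonneg.2 (Real.log_nonpos (hδ.le.trans (le_smoothing hδ1 hu)) (smoothing_le_one hδ1 hu1))

theorem smoothLog_le (hδ : 0 < δ) (hδ1 : δ < 1) (hu : 0 ≤ u) : smoothLog δ u ≤ -Real.log δ :=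
  neg_le_neg (Real.log_le_log hδ (le_smoothing hδ1 hu))

theorem abs_smoothLog_le (hδ : 0 < δ) (hδ1 : δ < 1) (hu : 0 ≤ u) (hu1 : u ≤ 1) :
    |smoothLog δ u| ≤ -Real.log δ := by
  rw [abs_of_nonneg (smoothLog_nonneg hδ hδ1 hu hu1)]
  exact smoothLog_le hδ hδ1 hu

/-- The argument of the logarithm is `u + δ * (1 - u)`, increasing in `δ` when `u ≤ 1`. -/
theorem smoothLog_antitone {δ' : ℝ} (hδ : 0 < δ) (hδδ' : δ ≤ δ') (hδ1 : δ < 1) (hu : 0 ≤ u)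
    (hu1 : u ≤ 1) : smoothLog δ' u ≤ smoothLog δ u :=
  neg_le_neg (Real.log_le_log (hδ.trans_le (le_smoothing hδ1 hu)) (by nlinarith))

theorem smoothLog_le_neg_log (hδ : 0 < δ) (hu : 0 < u) (hu1 : u ≤ 1) :
    smoothLog δ u ≤ -Real.log u :=
  neg_le_neg (Real.log_le_log hu (by nlinarith))

theorem smoothLog_convex (hδ : 0 < δ) (hδ1 : δ < 1) {v a b : ℝ} (hu : 0 ≤ u) (hv : 0 ≤ v)
    (ha : 0 ≤ a) (hb : 0 ≤ b) (hab : a + b = 1) :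
    smoothLog δ (a * u + b * v) ≤ a * smoothLog δ u + b * smoothLog δ v := by
  have h := strictConcaveOn_log_Ioi.concaveOn.2
    (show (1 - δ) * u + δ ∈ Set.Ioi 0 from hδ.trans_le (le_smoothing hδ1 hu))
    (show (1 - δ) * v + δ ∈ Set.Ioi 0 from hδ.trans_le (le_smoothing hδ1 hv)) ha hb hab
  simp only [smul_eq_mul] at h
  have e : a * ((1 - δ) * u + δ) + b * ((1 - δ) * v + δ) = (1 - δ) * (a * u + b * v) + δ := by
    linear_combination δ * hab
  rw [e] at h
  simp only [smoothLog]
  linarith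

theorem continuousOn_smoothLog (hδ : 0 < δ) (hδ1 : δ < 1) :
    ContinuousOn (smoothLog δ) (Set.Ici 0) := by
  refine (ContinuousOn.log (by fun_prop) fun u hu => ?_).neg
  exact (hδ.trans_le (le_smoothing hδ1 hu)).ne'

end smoothLog

/-! ### The game of a single round -/

theorem summable_toReal {O : Type*} (p : PMF O) : Summable fun o => (p o).toReal :=
  ENNReal.summable_toReal p.tsum_coe_ne_top

theorem tsum_toReal {O : Type*} (p : PMF O) : ∑' o, (p o).toReal = 1 := by
  rw [← ENNReal.tsum_toReal_eq p.apply_ne_top, p.tsum_coe, ENNReal.toReal_one]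

variable {Pol O Φ : Type*} [Fintype Pol] [Fintype Φ]

/-- The strategies of the learner in a single round: a distribution of the policy, and for every
policy and observation an updated belief about the parameter in `Φ`. -/
def strategies (Pol O Φ : Type*) [Fintype Pol] [Fintype Φ] :
    Set ((Pol → ℝ) × (Pol → O → Φ → ℝ)) :=
  stdSimplex ℝ Pol ×ˢ Set.univ.pi fun _ => Set.univ.pi fun _ => stdSimplex ℝ Φ

/-- The expected loss of a strategy: the regret against `star`, shifted by `1`, plus the
smoothed logarithmic loss of the updated belief in `φ`. -/
def roundLoss (η δ : ℝ) (star : Pol) (φ : Φ) (M : Model Pol O)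
    (x : (Pol → ℝ) × (Pol → O → Φ → ℝ)) : ℝ :=
  ∑ π, x.1 π * (1 + M.value star - M.value π
    + η⁻¹ * ∑' o, (M.law π o).toReal * smoothLog δ (x.2 π o φ))

theorem mem_stdSimplex_le_one {ι : Type*} [Fintype ι] {w : ι → ℝ} (hw : w ∈ stdSimplex ℝ ι)
    (i : ι) : w i ≤ 1 :=
  (Finset.single_le_sum (fun j _ => hw.1 j) (Finset.mem_univ i)).trans_eq hw.2

theorem belief_mem {x : (Pol → ℝ) × (Pol → O → Φ → ℝ)} (hx : x ∈ strategies Pol O Φ)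
    (π : Pol) (o : O) : x.2 π o ∈ stdSimplex ℝ Φ :=
  hx.2 π trivial o trivial

/-- Tychonoff: beliefs carry the product topology over a possibly infinite set of observations. -/
theorem isCompact_strategies : IsCompact (strategies Pol O Φ) :=
  (isCompact_stdSimplex ℝ Pol).prod
    (isCompact_univ_pi fun _ => isCompact_univ_pi fun _ => isCompact_stdSimplex ℝ Φ)

theorem norm_law_mul_smoothLog_le {δ : ℝ} (hδ : 0 < δ) (hδ1 : δ < 1) (p : PMF O)
    {x : (Pol → ℝ) × (Pol → O → Φ → ℝ)} (hx : x ∈ strategies Pol O Φ) (π : Pol) (φ : Φ) (o : O) :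
    ‖(p o).toReal * smoothLog δ (x.2 π o φ)‖ ≤ (p o).toReal * -Real.log δ := by
  rw [norm_mul, Real.norm_of_nonneg ENNReal.toReal_nonneg]
  exact mul_le_mul_of_nonneg_left (abs_smoothLog_le hδ hδ1 ((belief_mem hx π o).1 φ)
    (mem_stdSimplex_le_one (belief_mem hx π o) φ)) ENNReal.toReal_nonneg

theorem summable_law_mul_smoothLog {δ : ℝ} (hδ : 0 < δ) (hδ1 : δ < 1) (p : PMF O)
    {x : (Pol → ℝ) × (Pol → O → Φ → ℝ)} (hx : x ∈ strategies Pol O Φ) (π : Pol) (φ : Φ) :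
    Summable fun o => (p o).toReal * smoothLog δ (x.2 π o φ) :=
  Summable.of_norm_bounded ((summable_toReal p).mul_right _)
    (norm_law_mul_smoothLog_le hδ hδ1 p hx π φ)

/-- Smoothing bounds the log loss by `-log δ`, so the series over observations is dominated by a
summable one, uniformly in the strategy. -/
theorem continuousOn_roundLoss (η : ℝ) {δ : ℝ} (hδ : 0 < δ) (hδ1 : δ < 1) (star : Pol) (φ : Φ)
    (M : Model Pol O) : ContinuousOn (roundLoss η δ star φ M) (strategies Pol O Φ) := by
  refine continuousOn_finsetSum _ fun π _ => ContinuousOn.mul (by fun_prop) ?_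
  refine ContinuousOn.add continuousOn_const (ContinuousOn.mul continuousOn_const ?_)
  refine continuousOn_tsum (fun o => ?_) ((summable_toReal (M.law π)).mul_right (-Real.log δ))
    fun o x hx => norm_law_mul_smoothLog_le hδ hδ1 _ hx π φ o
  refine continuousOn_const.mul ((continuousOn_smoothLog hδ hδ1).comp (by fun_prop) ?_)
  exact fun x hx => (belief_mem hx π o).1 φ

/-- This lets one small `δ` serve for finitely many smoothing levels at once. -/
theorem roundLoss_antitone {η : ℝ} (hη : 0 < η) {δ δ' : ℝ} (hδ : 0 < δ) (hδδ' : δ ≤ δ')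
    (hδ1 : δ' < 1) (star : Pol) (φ : Φ) (M : Model Pol O)
    {x : (Pol → ℝ) × (Pol → O → Φ → ℝ)} (hx : x ∈ strategies Pol O Φ) :
    roundLoss η δ' star φ M x ≤ roundLoss η δ star φ M x := by
  refine Finset.sum_le_sum fun π _ => mul_le_mul_of_nonneg_left ?_ (hx.1.1 π)
  refine add_le_add le_rfl (mul_le_mul_of_nonneg_left ?_ (inv_nonneg.2 hη.le))
  refine Summable.tsum_le_tsum (fun o => ?_)
    (summable_law_mul_smoothLog (hδ.trans_le hδδ') hδ1 _ hx π φ)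
    (summable_law_mul_smoothLog hδ (hδδ'.trans_lt hδ1) _ hx π φ)
  exact mul_le_mul_of_nonneg_left (smoothLog_antitone hδ hδδ' (hδδ'.trans_lt hδ1)
    ((belief_mem hx π o).1 φ) (mem_stdSimplex_le_one (belief_mem hx π o) φ)) ENNReal.toReal_nonneg

/-- The loss is convexlike: the mixture of two strategies uses the conditional mean of the
beliefs given the policy. -/
theorem exists_roundLoss_le_mix {η : ℝ} (hη : 0 < η) {x y : (Pol → ℝ) × (Pol → O → Φ → ℝ)}
    (hx : x ∈ strategies Pol O Φ) (hy : y ∈ strategies Pol O Φ) {a b : ℝ} (ha : 0 ≤ a)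
    (hb : 0 ≤ b) (hab : a + b = 1) :
    ∃ z ∈ strategies Pol O Φ, ∀ δ : ℝ, 0 < δ → δ < 1 → ∀ (star : Pol) (φ : Φ) (M : Model Pol O),
      roundLoss η δ star φ M z ≤ a * roundLoss η δ star φ M x + b * roundLoss η δ star φ M y := by
  let q : Pol → ℝ := fun π => a * x.1 π + b * y.1 π
  have hax : ∀ π, 0 ≤ a * x.1 π := fun π => mul_nonneg ha (hx.1.1 π)
  have hby : ∀ π, 0 ≤ b * y.1 π := fun π => mul_nonneg hb (hy.1.1 π)
  have hq : ∀ π, 0 ≤ q π := fun π => add_nonneg (hax π) (hby π)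
  -- Policies with `q π = 0` carry no weight in the loss; `x.2` there only keeps `z` a strategy.
  let z : (Pol → ℝ) × (Pol → O → Φ → ℝ) := (q, fun π o =>
    if q π = 0 then x.2 π o else (a * x.1 π / q π) • x.2 π o + (b * y.1 π / q π) • y.2 π o)
  have hz : z ∈ strategies Pol O Φ := by
    refine ⟨convex_stdSimplex ℝ Pol hx.1 hy.1 ha hb hab, fun π _ o _ => ?_⟩
    simp only [z]
    split_ifs with h0
    · exact belief_mem hx π o
    · refine convex_stdSimplex ℝ Φ (belief_mem hx π o) (belief_mem hy π o)
        (div_nonneg (hax π) (hq π)) (div_nonneg (hby π) (hq π)) ?_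
      rw [← add_div]; exact div_self h0
  refine ⟨z, hz, fun δ hδ hδ1 star φ M => ?_⟩
  simp only [roundLoss]
  rw [Finset.mul_sum, Finset.mul_sum, ← Finset.sum_add_distrib]
  refine Finset.sum_le_sum fun π _ => ?_
  by_cases h0 : q π = 0
  · have h1 : a * x.1 π = 0 := le_antisymm (by have := hby π; simp only [q] at h0; linarith) (hax π)
    have h2 : b * y.1 π = 0 := le_antisymm (by simp only [q] at h0; linarith) (hby π)
    have h3 : z.1 π = 0 := h0
    rw [h3, ← mul_assoc, ← mul_assoc, h1, h2]
    simp
  · have hqp : 0 < q π := (hq π).lt_of_ne' h0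
    have hab' : a * x.1 π / q π + b * y.1 π / q π = 1 := by rw [← add_div]; exact div_self h0
    have hsx := summable_law_mul_smoothLog hδ hδ1 (M.law π) hx π φ
    have hsy := summable_law_mul_smoothLog hδ hδ1 (M.law π) hy π φ
    have key : ∑' o, (M.law π o).toReal * smoothLog δ (z.2 π o φ)
        ≤ a * x.1 π / q π * ∑' o, (M.law π o).toReal * smoothLog δ (x.2 π o φ)
          + b * y.1 π / q π * ∑' o, (M.law π o).toReal * smoothLog δ (y.2 π o φ) := by
      rw [← tsum_mul_left, ← tsum_mul_left, ← (hsx.mul_left _).tsum_add (hsy.mul_left _)]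
      refine Summable.tsum_le_tsum (fun o => ?_)
        (summable_law_mul_smoothLog hδ hδ1 (M.law π) hz π φ)
        ((hsx.mul_left _).add (hsy.mul_left _))
      have hzu : z.2 π o φ
          = a * x.1 π / q π * x.2 π o φ + b * y.1 π / q π * y.2 π o φ := by
        simp [z, h0]
      have := mul_le_mul_of_nonneg_left (smoothLog_convex hδ hδ1 ((belief_mem hx π o).1 φ)
        ((belief_mem hy π o).1 φ) (div_nonneg (hax π) (hq π)) (div_nonneg (hby π) (hq π)) hab')
        (ENNReal.toReal_nonneg (a := M.law π o))
      rw [hzu]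
      linarith
    have hzq : z.1 π = q π := rfl
    rw [hzq]
    have h4 := mul_le_mul_of_nonneg_left key (mul_nonneg hqp.le (inv_nonneg.2 hη.le))
    have e1 : ∀ A B : ℝ, q π * η⁻¹ * (a * x.1 π / q π * A + b * y.1 π / q π * B)
        = η⁻¹ * (a * x.1 π * A + b * y.1 π * B) := fun A B => by field_simp
    rw [e1] at h4
    have e2 : q π = a * x.1 π + b * y.1 π := rfl
    nlinarith [h4, e2]

/-! ### Bayesian updates -/

/-- A distribution on a finite type, from a point of the simplex. -/
def simplexPMF {ι : Type*} [Fintype ι] (w : ι → ℝ) (hw : w ∈ stdSimplex ℝ ι) : PMF ι :=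
  PMF.ofFintype (fun i => ENNReal.ofReal (w i)) (by
    rw [← ENNReal.ofReal_sum_of_nonneg fun i _ => hw.1 i, hw.2, ENNReal.ofReal_one])

theorem toReal_mem_stdSimplex {ι : Type*} [Fintype ι] (p : PMF ι) :
    (fun i => (p i).toReal) ∈ stdSimplex ℝ ι :=
  ⟨fun _ => ENNReal.toReal_nonneg, by rw [← tsum_fintype (L := .unconditional _)]; exact tsum_toReal p⟩

/-- Against a prior `W` on finitely many models, the strategy which consists of the distribution
from the decision-estimation coefficient and of the posterior has small loss. -/
theorem exists_roundLoss_le_of_prior [Nonempty Pol] {η : ℝ} (hη : 0 < η)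
    {𝓜 : Set (Model Pol O)} {c : ℝ} (hc : DEC η 𝓜 < c) (star : Φ → Pol) (M : Φ → Model Pol O)
    (hM : ∀ φ, M φ ∈ 𝓜) {W : Φ → ℝ} (hW : W ∈ stdSimplex ℝ Φ) {δ : ℝ} (hδ : 0 < δ) (hδ1 : δ < 1) :
    ∃ x ∈ strategies Pol O Φ, ∀ φ, 0 < W φ →
      roundLoss η δ (star φ) φ (M φ) x ≤ 1 + c - η⁻¹ * Real.log (W φ) := by
  let μ := (simplexPMF W hW).map M
  let Mbar : Pol → PMF O := fun π => μ.bind fun N => N.law π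
  have hbar : ∀ π o, Mbar π o = ∑ φ, ENNReal.ofReal (W φ) * (M φ).law π o := fun π o => by
    simp only [Mbar, μ]
    rw [PMF.bind_map, PMF.bind_apply, tsum_fintype]
    rfl
  have hco : Mbar ∈ co 𝓜 := by
    refine ⟨μ, ?_, ?_, fun _ => rfl⟩
    · rw [PMF.support_map]; exact (Set.toFinite _).image _
    · rw [PMF.support_map]; rintro _ ⟨φ, _, rfl⟩; exact hM φ
  obtain ⟨p, hp⟩ := iInf_lt_iff.1 ((le_iSup₂ (f := fun (Mb : Pol → PMF O) (_ : Mb ∈ co 𝓜) =>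
    ⨅ p : PMF Pol, ⨆ M ∈ 𝓜, decObjective η Mb p M) Mbar hco).trans_lt hc)
  have hle : ∀ π o φ, ENNReal.ofReal (W φ) * (M φ).law π o ≤ Mbar π o := fun π o φ => by
    rw [hbar]
    exact Finset.single_le_sum (f := fun φ => ENNReal.ofReal (W φ) * (M φ).law π o)
      (fun _ _ => zero_le) (Finset.mem_univ φ)
  have hbarR : ∀ π o, (Mbar π o).toReal = ∑ φ, W φ * ((M φ).law π o).toReal := fun π o => by
    rw [hbar, ENNReal.toReal_sum fun φ _ =>
      ENNReal.mul_ne_top ENNReal.ofReal_ne_top (PMF.apply_ne_top _ _)]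
    simp [ENNReal.toReal_ofReal, hW.1]
  -- The Bayes posterior. Observations with `Mbar π o = 0` are impossible under every model of
  -- positive prior weight, so the default `W` is harmless.
  let x : (Pol → ℝ) × (Pol → O → Φ → ℝ) := (fun π => (p π).toReal, fun π o φ =>
    if Mbar π o = 0 then W φ else W φ * (((M φ).law π o).toReal / (Mbar π o).toReal))
  have hx : x ∈ strategies Pol O Φ := by
    refine ⟨toReal_mem_stdSimplex p, fun π _ o _ => ?_⟩
    by_cases h0 : Mbar π o = 0
    · simpa [x, h0] using hW
    · have hpos : 0 < (Mbar π o).toReal := ENNReal.toReal_pos h0 (PMF.apply_ne_top _ _)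
      simp only [x, h0, if_false]
      refine ⟨fun φ => mul_nonneg (hW.1 φ) (div_nonneg ENNReal.toReal_nonneg hpos.le), ?_⟩
      simp only [← mul_div_assoc, ← Finset.sum_div]
      rw [← hbarR, div_self hpos.ne']
  refine ⟨x, hx, fun φ hφ => ?_⟩
  have hkl : ∀ π, kl ((M φ).law π) (Mbar π) ≠ ∞ ∧
      ∑' o, ((M φ).law π o).toReal * smoothLog δ (x.2 π o φ)
        ≤ -Real.log (W φ) - (kl ((M φ).law π) (Mbar π)).toReal := fun π => by
    refine tsum_mul_le_neg_log_sub_kl _ _ hφ (fun o => hle π o φ) _ (-Real.log δ)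
      (fun o => abs_smoothLog_le hδ hδ1 ((belief_mem hx π o).1 φ)
        (mem_stdSimplex_le_one (belief_mem hx π o) φ)) fun o ho => ?_
    have h0 : Mbar π o ≠ 0 := fun h0 => by
      have := hle π o φ
      rw [h0, nonpos_iff_eq_zero, mul_eq_zero] at this
      exact this.elim (by simpa using hφ) ho
    have hu : x.2 π o φ = W φ * (((M φ).law π o).toReal / (Mbar π o).toReal) := by
      simp [x, h0]
    rw [← hu]
    refine smoothLog_le_neg_log hδ ?_ (mem_stdSimplex_le_one (belief_mem hx π o) φ)
    rw [hu]
    exact mul_pos hφ (div_pos (ENNReal.toReal_pos ho (PMF.apply_ne_top _ _))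
      (ENNReal.toReal_pos h0 (PMF.apply_ne_top _ _)))
  have hobj : decObjective η Mbar p (M φ) ≤ c :=
    (le_iSup₂ (f := fun N (_ : N ∈ 𝓜) => decObjective η Mbar p N) (M φ) (hM φ)).trans hp.le
  -- All divergences are finite, so the extended-real DEC bound becomes a real inequality.
  have hB : ENNReal.ofReal η⁻¹ * ∑ π, p π * kl ((M φ).law π) (Mbar π)
      = ENNReal.ofReal (η⁻¹ * ∑ π, (p π).toReal * (kl ((M φ).law π) (Mbar π)).toReal) := by
    rw [ENNReal.ofReal_mul (inv_nonneg.2 hη.le), ENNReal.ofReal_sum_of_nonneg fun π _ => by positivity]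
    congr 1
    refine Finset.sum_congr rfl fun π _ => ?_
    rw [ENNReal.ofReal_mul ENNReal.toReal_nonneg, ENNReal.ofReal_toReal (PMF.apply_ne_top _ _),
      ENNReal.ofReal_toReal (hkl π).1]
  rw [decObjective, hB, EReal.coe_ennreal_ofReal, max_eq_left (by positivity), ← EReal.coe_sub,
    EReal.coe_le_coe_iff] at hobj
  have hsup : (M φ).value (star φ) ≤ ⨆ π', (M φ).value π' :=
    le_ciSup (Set.finite_range _).bddAbove _
  have hp1 := (toReal_mem_stdSimplex p).2
  calc roundLoss η δ (star φ) φ (M φ) x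
      ≤ ∑ π, (p π).toReal * (1 + (⨆ π', (M φ).value π') - (M φ).value π
          + η⁻¹ * (-Real.log (W φ) - (kl ((M φ).law π) (Mbar π)).toReal)) := by
        refine Finset.sum_le_sum fun π _ => mul_le_mul_of_nonneg_left ?_ ENNReal.toReal_nonneg
        have := mul_le_mul_of_nonneg_left (hkl π).2 (inv_nonneg.2 hη.le)
        linarith
    _ = (1 - η⁻¹ * Real.log (W φ)) * ∑ π, (p π).toReal
        + (∑ π, (p π).toReal * ((⨆ π', (M φ).value π') - (M φ).value π)
          - η⁻¹ * ∑ π, (p π).toReal * (kl ((M φ).law π) (Mbar π)).toReal) := by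
        simp only [Finset.mul_sum]
        rw [← Finset.sum_sub_distrib, ← Finset.sum_add_distrib]
        exact Finset.sum_congr rfl fun π _ => by ring
    _ ≤ _ := by rw [hp1]; linarith

end

section

variable {Pol O Φ : Type*} [Fintype Pol] [Fintype Φ]

/-! ### Mixtures of models -/

/-- The observation probabilities and the values of a model, as a point of a vector space. -/
def coords (M : Model Pol O) : (Pol → O → ℝ) × (Pol → ℝ) :=
  (fun π o => (M.law π o).toReal, M.value)

/-- The loss is affine in the observation probabilities and values of the model. -/
theorem roundLoss_of_coords_eq_sum {η δ : ℝ} (hδ : 0 < δ) (hδ1 : δ < 1) {ι : Type*}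
    (t : Finset ι) (w : ι → ℝ) (hw : ∑ i ∈ t, w i = 1) (N : ι → Model Pol O) (M : Model Pol O)
    (hM : coords M = ∑ i ∈ t, w i • coords (N i)) (star : Pol) (φ : Φ)
    {x : (Pol → ℝ) × (Pol → O → Φ → ℝ)} (hx : x ∈ strategies Pol O Φ) :
    roundLoss η δ star φ M x = ∑ i ∈ t, w i * roundLoss η δ star φ (N i) x := by
  have hval : ∀ π, M.value π = ∑ i ∈ t, w i * (N i).value π := fun π => by
    have := congrFun (congrArg Prod.snd hM) π
    simpa [coords, Prod.snd_sum, Finset.sum_apply] using this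
  have hlaw : ∀ π o, (M.law π o).toReal = ∑ i ∈ t, w i * ((N i).law π o).toReal := fun π o => by
    have := congrFun (congrFun (congrArg Prod.fst hM) π) o
    simpa [coords, Prod.fst_sum, Finset.sum_apply] using this
  have hts : ∀ π, ∑' o, (M.law π o).toReal * smoothLog δ (x.2 π o φ)
      = ∑ i ∈ t, w i * ∑' o, ((N i).law π o).toReal * smoothLog δ (x.2 π o φ) := fun π => by
    simp only [hlaw, Finset.sum_mul, mul_assoc]
    rw [Summable.tsum_finsetSum fun i _ =>
      (summable_law_mul_smoothLog hδ hδ1 ((N i).law π) hx π φ).mul_left (w i)]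
    exact Finset.sum_congr rfl fun i _ => tsum_mul_left
  simp only [roundLoss]
  simp only [hts, hval, Finset.mul_sum]
  rw [Finset.sum_comm]
  refine Finset.sum_congr rfl fun π _ => ?_
  -- The constant shift in the loss survives mixing because the weights sum to one.
  have e : (1 : ℝ) = ∑ i ∈ t, w i := hw.symm
  conv_lhs => rw [e]
  rw [← Finset.sum_add_distrib, ← Finset.sum_sub_distrib, ← Finset.sum_add_distrib, Finset.mul_sum]
  exact Finset.sum_congr rfl fun i _ => by ring

/-- Left unnormalized so that parameters of total weight zero are covered, where any model of `K`
will do. -/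
theorem exists_mul_roundLoss_eq_sum {η δ : ℝ} (hδ : 0 < δ) (hδ1 : δ < 1) {K : Set (Model Pol O)}
    (hK : Convex ℝ (coords '' K)) (hne : K.Nonempty) {ι : Type*} (t : Finset ι) (w : ι → ℝ)
    (hw : ∀ i ∈ t, 0 ≤ w i) (N : ι → Model Pol O) (hN : ∀ i ∈ t, N i ∈ K) (star : Pol) (φ : Φ) :
    ∃ M ∈ K, ∀ x ∈ strategies Pol O Φ,
      (∑ i ∈ t, w i) * roundLoss η δ star φ M x = ∑ i ∈ t, w i * roundLoss η δ star φ (N i) x := by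
  rcases (Finset.sum_nonneg hw).eq_or_lt with h0 | h0
  · obtain ⟨M, hM⟩ := hne
    refine ⟨M, hM, fun x _ => ?_⟩
    have hz := (Finset.sum_eq_zero_iff_of_nonneg hw).1 h0.symm
    rw [← h0, zero_mul]
    exact (Finset.sum_eq_zero fun i hi => by rw [hz i hi, zero_mul]).symm
  · obtain ⟨M, hM, hMe⟩ := hK.sum_mem (t := t) (w := fun i => w i / ∑ j ∈ t, w j)
      (z := fun i => coords (N i)) (fun i hi => div_nonneg (hw i hi) h0.le)
      (by rw [← Finset.sum_div, div_self h0.ne']) (fun i hi => ⟨N i, hN i hi, rfl⟩)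
    refine ⟨M, hM, fun x hx => ?_⟩
    rw [roundLoss_of_coords_eq_sum hδ hδ1 t _ (by rw [← Finset.sum_div, div_self h0.ne']) N M hMe
      star φ hx, Finset.mul_sum]
    refine Finset.sum_congr rfl fun i _ => ?_
    rw [← mul_assoc, mul_div_cancel₀ _ h0.ne']

/-- Gibbs' inequality. -/
theorem sum_mul_neg_log_le {W ρ : Φ → ℝ} (hW : W ∈ stdSimplex ℝ Φ) (hρ : ρ ∈ stdSimplex ℝ Φ)
    (h : ∀ φ, 0 < W φ → 0 < ρ φ) :
    ∑ φ, W φ * -Real.log (W φ) ≤ ∑ φ, W φ * -Real.log (ρ φ) := by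
  have : ∑ φ, (W φ * -Real.log (W φ) - W φ * -Real.log (ρ φ)) ≤ ∑ φ, (ρ φ - W φ) := by
    refine Finset.sum_le_sum fun φ _ => ?_
    rcases (hW.1 φ).eq_or_lt with h0 | h0
    · simpa [← h0] using hρ.1 φ
    · have h1 := Real.log_le_sub_one_of_pos (div_pos (h φ h0) h0)
      rw [Real.log_div (h φ h0).ne' h0.ne'] at h1
      have h2 := mul_le_mul_of_nonneg_left h1 h0.le
      have h3 : W φ * (ρ φ / W φ - 1) = ρ φ - W φ := by field_simp
      linarith
  rw [Finset.sum_sub_distrib, Finset.sum_sub_distrib, hW.2, hρ.2] at this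
  linarith

/-! ### The optimal strategy of a round -/

/-- Mixed against finitely many models, some strategy has loss below the entropy relative to
the belief `ρ` plus the decision-estimation coefficient. -/
theorem exists_sum_mul_roundLoss_le [Nonempty Pol] {η : ℝ} (hη : 0 < η) {𝓜 : Set (Model Pol O)}
    {c : ℝ} (hc : DEC η 𝓜 < c) (star : Φ → Pol) (K : Φ → Set (Model Pol O))
    (hne : ∀ φ, (K φ).Nonempty) (hconv : ∀ φ, Convex ℝ (coords '' K φ)) (hK : ∀ φ, K φ ⊆ 𝓜)
    {ρ : Φ → ℝ} (hρ : ρ ∈ stdSimplex ℝ Φ) {δ : ℝ} (hδ : 0 < δ) (hδ1 : δ < 1) {ι : Type*}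
    [Fintype ι] (par : ι → Φ) (hpar : ∀ i, 0 < ρ (par i)) (N : ι → Model Pol O)
    (hN : ∀ i, N i ∈ K (par i)) {w : ι → ℝ} (hw : w ∈ stdSimplex ℝ ι) :
    ∃ x ∈ strategies Pol O Φ, ∑ i, w i * roundLoss η δ (star (par i)) (par i) (N i) x
      ≤ ∑ i, w i * (1 + c - η⁻¹ * Real.log (ρ (par i))) := by
  classical
  -- The marginal of the mixture on the parameter, used as the prior.
  let W : Φ → ℝ := fun φ => ∑ i with par i = φ, w i
  have hsum : ∀ g : Φ → ℝ, ∑ φ, W φ * g φ = ∑ i, w i * g (par i) := fun g => by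
    rw [← Finset.sum_fiberwise Finset.univ par]
    refine Finset.sum_congr rfl fun φ _ => ?_
    rw [Finset.sum_mul]
    exact Finset.sum_congr rfl fun i hi => by rw [(Finset.mem_filter.1 hi).2]
  have hW : W ∈ stdSimplex ℝ Φ :=
    ⟨fun φ => Finset.sum_nonneg fun i _ => hw.1 i, by simpa [hw.2] using hsum fun _ => 1⟩
  have hWρ : ∀ φ, 0 < W φ → 0 < ρ φ := fun φ hφ => by
    obtain ⟨i, hi, _⟩ := Finset.exists_ne_zero_of_sum_ne_zero hφ.ne'
    rw [← (Finset.mem_filter.1 hi).2]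
    exact hpar i
  choose M hMK hM using fun φ => exists_mul_roundLoss_eq_sum (η := η) hδ hδ1 (hconv φ) (hne φ)
    (Finset.univ.filter fun i => par i = φ) w (fun i _ => hw.1 i) N
    (fun i hi => (Finset.mem_filter.1 hi).2 ▸ hN i) (star φ) φ
  obtain ⟨x, hx, hxle⟩ :=
    exists_roundLoss_le_of_prior hη hc star M (fun φ => hK φ (hMK φ)) hW hδ hδ1
  refine ⟨x, hx, ?_⟩
  calc ∑ i, w i * roundLoss η δ (star (par i)) (par i) (N i) x
      = ∑ φ, W φ * roundLoss η δ (star φ) φ (M φ) x := by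
        rw [← Finset.sum_fiberwise Finset.univ par]
        refine Finset.sum_congr rfl fun φ _ => ?_
        rw [hM φ x hx]
        exact Finset.sum_congr rfl fun i hi => by rw [(Finset.mem_filter.1 hi).2]
    _ ≤ ∑ φ, W φ * (1 + c - η⁻¹ * Real.log (W φ)) := by
        refine Finset.sum_le_sum fun φ _ => ?_
        rcases (hW.1 φ).eq_or_lt with h0 | h0
        · simp [← h0]
        · exact mul_le_mul_of_nonneg_left (hxle φ h0) h0.le
    _ = (1 + c) * ∑ φ, W φ + η⁻¹ * ∑ φ, W φ * -Real.log (W φ) := by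
        rw [Finset.mul_sum, Finset.mul_sum, ← Finset.sum_add_distrib]
        exact Finset.sum_congr rfl fun φ _ => by ring
    _ ≤ (1 + c) * ∑ φ, W φ + η⁻¹ * ∑ φ, W φ * -Real.log (ρ φ) :=
        add_le_add le_rfl
          (mul_le_mul_of_nonneg_left (sum_mul_neg_log_le hW hρ hWρ) (inv_nonneg.2 hη.le))
    _ = ∑ φ, W φ * (1 + c - η⁻¹ * Real.log (ρ φ)) := by
        rw [Finset.mul_sum, Finset.mul_sum, ← Finset.sum_add_distrib]
        exact Finset.sum_congr rfl fun φ _ => by ring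
    _ = _ := hsum fun φ => 1 + c - η⁻¹ * Real.log (ρ φ)

theorem strategies_nonempty [Nonempty Pol] [Nonempty Φ] : (strategies Pol O Φ).Nonempty := by
  classical
  obtain ⟨π⟩ := ‹Nonempty Pol›
  obtain ⟨φ⟩ := ‹Nonempty Φ›
  exact ⟨(Pi.single π 1, fun _ _ => Pi.single φ 1), single_mem_stdSimplex ℝ π,
    fun _ _ _ _ => single_mem_stdSimplex ℝ φ⟩

/-- For every belief `ρ` there is a strategy whose loss against each parameter `φ` and each model
in `K φ` is at most the decision-estimation coefficient plus the logarithmic loss of `ρ`. -/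
theorem exists_strategy [Nonempty Pol] {η : ℝ} (hη : 0 < η) {𝓜 : Set (Model Pol O)}
    {c : ℝ} (hc : DEC η 𝓜 ≤ c) (star : Φ → Pol) (K : Φ → Set (Model Pol O))
    (hne : ∀ φ, (K φ).Nonempty) (hconv : ∀ φ, Convex ℝ (coords '' K φ)) (hK : ∀ φ, K φ ⊆ 𝓜)
    {ρ : Φ → ℝ} (hρ : ρ ∈ stdSimplex ℝ Φ) :
    ∃ x ∈ strategies Pol O Φ, ∀ φ, 0 < ρ φ → ∀ M ∈ K φ, ∀ δ : ℝ, 0 < δ → δ < 1 →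
      roundLoss η δ (star φ) φ M x ≤ 1 + c - η⁻¹ * Real.log (ρ φ) := by
  classical
  have : Nonempty Φ := by
    by_contra h
    rw [not_nonempty_iff] at h
    simpa using hρ.2
  have : Nonempty (Set.Ioo (0 : ℝ) 1) := ⟨⟨1 / 2, by norm_num, by norm_num⟩⟩
  -- One constraint per parameter, model and smoothing level. Allowing slack equal to the level
  -- keeps strict inequalities available for finite subfamilies.
  let J := {j : (Φ × Model Pol O) × Set.Ioo (0 : ℝ) 1 // 0 < ρ j.1.1 ∧ j.1.2 ∈ K j.1.1}
  let C : J → ℝ := fun j => 1 + c - η⁻¹ * Real.log (ρ j.1.1.1)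
  let t : J → Set ((Pol → ℝ) × (Pol → O → Φ → ℝ)) := fun j => strategies Pol O Φ ∩
    roundLoss η j.1.2 (star j.1.1.1) j.1.1.1 j.1.1.2 ⁻¹' Set.Iic (C j + j.1.2)
  have hclosed : ∀ j, IsClosed (t j) := fun j =>
    (continuousOn_roundLoss η j.1.2.2.1 j.1.2.2.2 _ _ _).preimage_isClosed_of_isClosed
      isCompact_strategies.isClosed isClosed_Iic
  obtain ⟨x, hx, hxt⟩ := isCompact_strategies.inter_iInter_nonempty t hclosed (by
    intro u
    obtain ⟨⟨δ, hδ, hδ1⟩, hδle⟩ := (u.image fun j => j.1.2).bddBelow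
    -- Half of the slack makes the DEC bound strict, the other half the minimax hypothesis.
    have hDEC : DEC η 𝓜 < ((c + δ / 2 : ℝ) : EReal) :=
      hc.trans_lt (EReal.coe_lt_coe_iff.2 (by linarith))
    obtain ⟨x, hx, hxlt⟩ := exists_forall_lt_of_convexlike (strategies Pol O Φ)
      strategies_nonempty
      (fun j : u => roundLoss η δ (star j.1.1.1.1) j.1.1.1.1 j.1.1.1.2) (fun j => C j + δ)
      (fun x hx y hy a b ha hb hab => by
        obtain ⟨z, hz, hzle⟩ := exists_roundLoss_le_mix hη hx hy ha hb hab
        exact ⟨z, hz, fun j => hzle δ hδ hδ1 _ _ _⟩)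
      (fun w hw => by
        obtain ⟨x, hx, hxle⟩ := exists_sum_mul_roundLoss_le hη hDEC star K hne hconv hK hρ hδ hδ1
          (fun j : u => j.1.1.1.1) (fun j => j.1.2.1) (fun j => j.1.1.1.2) (fun j => j.1.2.2) hw
        refine ⟨x, hx, hxle.trans_lt ?_⟩
        have e : ∑ j, w j * (C j + δ)
            = ∑ j : u, w j * (1 + (c + δ / 2) - η⁻¹ * Real.log (ρ j.1.1.1.1))
              + δ / 2 * ∑ j, w j := by
          rw [Finset.mul_sum, ← Finset.sum_add_distrib]
          exact Finset.sum_congr rfl fun j _ => by simp only [C]; ring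
        rw [e, hw.2]
        linarith)
    refine ⟨x, hx, Set.mem_iInter₂.2 fun j hj => ⟨hx, ?_⟩⟩
    have hle : δ ≤ j.1.2 := hδle (Finset.mem_coe.2 (Finset.mem_image_of_mem (fun j : J => j.1.2) hj))
    have h1 := roundLoss_antitone hη hδ hle j.1.2.2.2 (star j.1.1.1) j.1.1.1 j.1.1.2 hx
    have h2 := hxlt ⟨j, hj⟩
    simp only [Set.mem_preimage, Set.mem_Iic]
    linarith)
  -- The constraint at level `min δ ε` has slack at most `ε` and, by monotonicity, controls level
  -- `δ`.
  refine ⟨x, hx, fun φ hφ M hM δ hδ hδ1 => le_of_forall_pos_le_add fun ε hε => ?_⟩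
  have hmin : 0 < min δ ε := lt_min hδ hε
  have hmin1 : min δ ε < 1 := (min_le_left _ _).trans_lt hδ1
  have h1 := (Set.mem_iInter.1 hxt ⟨((φ, M), ⟨min δ ε, hmin, hmin1⟩), hφ, hM⟩).2
  have h2 := roundLoss_antitone hη hmin (min_le_left _ _) hδ1 (star φ) φ M hx
  simp only [Set.mem_preimage, Set.mem_Iic, C] at h1
  have := min_le_right δ ε
  linarith

/-! ### Logarithmic loss with values in `[0, ∞]` -/

/-- The logarithmic loss `-log u` of `u ∈ [0, 1]`, infinite at `u = 0`. -/
def negLog (u : ℝ) : ℝ≥0∞ := ⨆ n : ℕ, ENNReal.ofReal (smoothLog ((n : ℝ) + 2)⁻¹ u)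

theorem inv_add_two_pos (n : ℕ) : 0 < ((n : ℝ) + 2)⁻¹ := by positivity

theorem inv_add_two_lt_one (n : ℕ) : ((n : ℝ) + 2)⁻¹ < 1 :=
  inv_lt_one_of_one_lt₀ (by have : (0 : ℝ) ≤ n := n.cast_nonneg; linarith)

theorem tendsto_inv_add_two :
    Filter.Tendsto (fun n : ℕ => ((n : ℝ) + 2)⁻¹) Filter.atTop (nhds 0) :=
  tendsto_inv_atTop_zero.comp
    (Filter.tendsto_atTop_add_const_right _ _ tendsto_natCast_atTop_atTop)

theorem negLog_zero : negLog 0 = ∞ := by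
  refine ENNReal.eq_top_of_forall_nnreal_le fun r => ?_
  obtain ⟨n, hn⟩ := exists_nat_ge (Real.exp r)
  refine le_iSup_of_le n ?_
  rw [← ENNReal.ofReal_coe_nnreal]
  refine ENNReal.ofReal_le_ofReal ?_
  simp only [smoothLog, mul_zero, zero_add, Real.log_inv, neg_neg]
  rw [Real.le_log_iff_exp_le (by positivity)]
  linarith

theorem negLog_le {u : ℝ} (hu : 0 < u) (hu1 : u ≤ 1) : negLog u ≤ ENNReal.ofReal (-Real.log u) :=
  iSup_le fun n => ENNReal.ofReal_le_ofReal (smoothLog_le_neg_log (inv_add_two_pos n) hu hu1)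

theorem le_negLog {u : ℝ} (hu : 0 < u) : ENNReal.ofReal (-Real.log u) ≤ negLog u := by
  have h : Filter.Tendsto (fun n : ℕ => ENNReal.ofReal (smoothLog ((n : ℝ) + 2)⁻¹ u)) Filter.atTop
      (nhds (ENNReal.ofReal (-Real.log u))) := by
    refine ENNReal.tendsto_ofReal (Filter.Tendsto.neg (Filter.Tendsto.log ?_ hu.ne'))
    have := ((tendsto_const_nhds (x := (1 : ℝ))).sub tendsto_inv_add_two).mul_const u |>.add
      tendsto_inv_add_two
    simpa using this
  exact le_of_tendsto' h fun n => le_iSup (fun n : ℕ => ENNReal.ofReal (smoothLog ((n : ℝ) + 2)⁻¹ u)) n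

theorem tsum_iSup_of_monotone {α : Type*} {f : α → ℕ → ℝ≥0∞} (hf : ∀ a, Monotone (f a)) :
    ∑' a, ⨆ n, f a n = ⨆ n, ∑' a, f a n := by
  let : MeasurableSpace α := ⊤
  simp only [← MeasureTheory.lintegral_count]
  exact MeasureTheory.lintegral_iSup (fun n _ _ => trivial) fun m n h a => hf a h

/-- Monotone convergence along the levels `1 / (n + 2)`. The shift by `1` in the loss keeps every
term nonnegative. -/
theorem sum_mul_add_tsum_negLog_le {η : ℝ} (hη : 0 < η) (star : Pol) (φ : Φ) (M : Model Pol O)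
    (hV : ∀ π, 0 ≤ 1 + M.value star - M.value π)
    {x : (Pol → ℝ) × (Pol → O → Φ → ℝ)} (hx : x ∈ strategies Pol O Φ) {C : ℝ}
    (h : ∀ δ : ℝ, 0 < δ → δ < 1 → roundLoss η δ star φ M x ≤ C) :
    ∑ π, ENNReal.ofReal (x.1 π) * (ENNReal.ofReal (1 + M.value star - M.value π)
      + ENNReal.ofReal η⁻¹ * ∑' o, M.law π o * negLog (x.2 π o φ)) ≤ ENNReal.ofReal C := by
  have hmono : ∀ π o, Monotone fun n : ℕ =>
      ENNReal.ofReal (smoothLog ((n : ℝ) + 2)⁻¹ (x.2 π o φ)) := fun π o m n hmn =>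
    ENNReal.ofReal_le_ofReal (smoothLog_antitone (inv_add_two_pos n)
      (inv_anti₀ (by positivity) (by gcongr)) (inv_add_two_lt_one n)
      ((belief_mem hx π o).1 φ) (mem_stdSimplex_le_one (belief_mem hx π o) φ))
  have hmono1 : ∀ π, Monotone fun n : ℕ =>
      ∑' o, M.law π o * ENNReal.ofReal (smoothLog ((n : ℝ) + 2)⁻¹ (x.2 π o φ)) :=
    fun π m n hmn => ENNReal.tsum_le_tsum fun o => mul_le_mul_right (hmono π o hmn) _
  have hsup : ∀ π, ∑' o, M.law π o * negLog (x.2 π o φ)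
      = ⨆ n : ℕ, ∑' o, M.law π o * ENNReal.ofReal (smoothLog ((n : ℝ) + 2)⁻¹ (x.2 π o φ)) := by
    intro π
    simp only [negLog, ENNReal.mul_iSup]
    exact tsum_iSup_of_monotone fun o m n hmn => mul_le_mul_right (hmono π o hmn) _
  simp only [hsup, ENNReal.mul_iSup, ENNReal.add_iSup]
  rw [ENNReal.finsetSum_iSup_of_monotone]
  swap
  · exact fun π m n hmn => mul_le_mul_right
      (add_le_add_right (mul_le_mul_right (hmono1 π hmn) _) _) _
  refine iSup_le fun n => ?_
  refine le_trans (le_of_eq ?_)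
    (ENNReal.ofReal_le_ofReal (h _ (inv_add_two_pos n) (inv_add_two_lt_one n)))
  have hg : ∀ π o, 0 ≤ smoothLog ((n : ℝ) + 2)⁻¹ (x.2 π o φ) := fun π o =>
    smoothLog_nonneg (inv_add_two_pos n) (inv_add_two_lt_one n) ((belief_mem hx π o).1 φ)
      (mem_stdSimplex_le_one (belief_mem hx π o) φ)
  have hs : ∀ π, 0 ≤ ∑' o, (M.law π o).toReal * smoothLog ((n : ℝ) + 2)⁻¹ (x.2 π o φ) :=
    fun π => tsum_nonneg fun o => mul_nonneg ENNReal.toReal_nonneg (hg π o)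
  have hη' := inv_nonneg.2 hη.le
  rw [roundLoss, ENNReal.ofReal_sum_of_nonneg fun π _ =>
    mul_nonneg (hx.1.1 π) (add_nonneg (hV π) (mul_nonneg hη' (hs π)))]
  refine Finset.sum_congr rfl fun π _ => ?_
  rw [ENNReal.ofReal_mul (hx.1.1 π), ENNReal.ofReal_add (hV π) (mul_nonneg hη' (hs π)),
    ENNReal.ofReal_mul hη', ENNReal.ofReal_tsum_of_nonneg
      (fun o => mul_nonneg ENNReal.toReal_nonneg (hg π o))
      (summable_law_mul_smoothLog (inv_add_two_pos n) (inv_add_two_lt_one n) _ hx π φ)]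
  simp only [ENNReal.ofReal_mul ENNReal.toReal_nonneg, ENNReal.ofReal_toReal (PMF.apply_ne_top _ _)]

/-- For every belief `ρ` there is a strategy whose loss against each parameter `φ` and each model
in `K φ` is at most the decision-estimation coefficient plus the logarithmic loss of `ρ`. -/
theorem exists_strategy_negLog [Nonempty Pol] {η : ℝ} (hη : 0 < η) {𝓜 : Set (Model Pol O)}
    {c : ℝ} (hc0 : 0 ≤ c) (hc : DEC η 𝓜 ≤ c) (star : Φ → Pol) (K : Φ → Set (Model Pol O))
    (hne : ∀ φ, (K φ).Nonempty) (hconv : ∀ φ, Convex ℝ (coords '' K φ)) (hK : ∀ φ, K φ ⊆ 𝓜)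
    (hV : ∀ φ, ∀ M ∈ K φ, ∀ π, M.value π ∈ Set.Icc (0 : ℝ) 1)
    {ρ : Φ → ℝ} (hρ : ρ ∈ stdSimplex ℝ Φ) :
    ∃ x ∈ strategies Pol O Φ, ∀ φ, ∀ M ∈ K φ,
      ∑ π, ENNReal.ofReal (x.1 π) * (ENNReal.ofReal (1 + M.value (star φ) - M.value π)
        + ENNReal.ofReal η⁻¹ * ∑' o, M.law π o * negLog (x.2 π o φ))
      ≤ ENNReal.ofReal (1 + c) + ENNReal.ofReal η⁻¹ * negLog (ρ φ) := by
  obtain ⟨x, hx, hxle⟩ := exists_strategy hη hc star K hne hconv hK hρ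
  refine ⟨x, hx, fun φ M hM => ?_⟩
  -- A parameter without belief has infinite potential, so its bound is vacuous.
  rcases (hρ.1 φ).eq_or_lt with h0 | h0
  · rw [← h0, negLog_zero, ENNReal.mul_top (by simpa using hη), add_top]
    exact le_top
  · have hlog : 0 ≤ -Real.log (ρ φ) :=
      neg_nonneg.2 (Real.log_nonpos h0.le (mem_stdSimplex_le_one hρ φ))
    refine (sum_mul_add_tsum_negLog_le hη (star φ) φ M (fun π => ?_) hx (hxle φ h0 M hM)).trans ?_
    · have := (hV φ M hM (star φ)).1
      have := (hV φ M hM π).2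
      linarith
    · rw [sub_eq_add_neg, ← mul_neg, ENNReal.ofReal_add (by linarith)
        (mul_nonneg (inv_nonneg.2 hη.le) hlog), ENNReal.ofReal_mul (inv_nonneg.2 hη.le)]
      gcongr
      exact le_negLog h0

end

/-! ### Elementary bounds on the decision-estimation coefficient -/

section DECBounds

variable {Pol O : Type*} [Fintype Pol]

/-- Take the reference to be a single model of the class: against itself its divergence vanishes and
only its suboptimality gap remains. -/
theorem DEC_nonneg (η : ℝ) {𝓜 : Set (Model Pol O)} (hne : 𝓜.Nonempty) : 0 ≤ DEC η 𝓜 := by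
  obtain ⟨M, hM⟩ := hne
  have hco : M.law ∈ co 𝓜 :=
    ⟨PMF.pure M, by simp, by simpa using hM, fun π => by rw [PMF.pure_bind]⟩
  refine le_iSup₂_of_le M.law hco (le_iInf fun p => le_iSup₂_of_le M hM ?_)
  simp only [decObjective, kl_self, mul_zero, Finset.sum_const_zero, EReal.coe_ennreal_zero,
    sub_zero]
  exact EReal.coe_nonneg.2 (Finset.sum_nonneg fun π _ => mul_nonneg ENNReal.toReal_nonneg
    (sub_nonneg.2 (le_ciSup (Set.finite_range _).bddAbove _)))

/-- Together with nonnegativity, this makes the DEC a real number. -/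
theorem DEC_le_one [Nonempty Pol] (η : ℝ) {𝓜 : Set (Model Pol O)}
    (hV : ∀ M ∈ 𝓜, ∀ π, M.value π ∈ Set.Icc (0 : ℝ) 1) : DEC η 𝓜 ≤ 1 := by
  refine iSup₂_le fun Mbar _ => iInf_le_of_le (PMF.pure (Classical.arbitrary Pol)) ?_
  refine iSup₂_le fun M hM => ?_
  refine (EReal.sub_le_sub le_rfl (EReal.coe_ennreal_nonneg _)).trans ?_
  rw [sub_zero, ← EReal.coe_one, EReal.coe_le_coe_iff]
  calc _ ≤ ∑ π, (PMF.pure (Classical.arbitrary Pol) π).toReal * 1 := by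
        refine Finset.sum_le_sum fun π _ =>
          mul_le_mul_of_nonneg_left ?_ ENNReal.toReal_nonneg
        have h1 : ⨆ π', M.value π' ≤ 1 := ciSup_le fun π' => (hV M hM π').2
        have h2 := (hV M hM π).1
        linarith
    _ = 1 := by simpa using (toReal_mem_stdSimplex (PMF.pure (Classical.arbitrary Pol))).2

end DECBounds

/-! ### The models of a fixed transition kernel -/

variable {S A F : Type*}

theorem cumReward_nonneg {R : Reward S A F} (hR : ∀ s a, 0 ≤ R.mean s a) (τ : Traj S A) :
    0 ≤ cumReward R τ :=
  List.sum_nonneg fun r hr => by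
    obtain ⟨x, _, rfl⟩ := List.mem_map.1 hr
    exact hR _ _

theorem cumReward_mix {R R' R'' : Reward S A F} {a b : ℝ}
    (h : ∀ s x, R''.mean s x = a * R.mean s x + b * R'.mean s x) (τ : Traj S A) :
    cumReward R'' τ = a * cumReward R τ + b * cumReward R' τ := by
  induction τ with
  | nil => simp [cumReward]
  | cons y τ ih =>
    simp only [cumReward, List.map_cons, List.sum_cons] at ih ⊢
    rw [ih, h]
    ring

section Values

variable {H : ℕ} {s₁ : S} {Pol : Finset (Policy S A)} {P : Transition S A}

theorem toReal_mul_cumReward_le {R : Reward S A F} {π : Policy S A}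
    (hτ : ∀ τ ∈ (trajLaw P π H s₁).support, cumReward R τ ≤ 1) (τ : Traj S A) :
    (trajLaw P π H s₁ τ).toReal * cumReward R τ ≤ (trajLaw P π H s₁ τ).toReal := by
  by_cases h0 : trajLaw P π H s₁ τ = 0
  · simp [h0]
  · exact mul_le_of_le_one_right ENNReal.toReal_nonneg (hτ τ ((PMF.mem_support_iff _ _).2 h0))

theorem summable_toReal_mul_cumReward {R : Reward S A F} (hR : ∀ s a, 0 ≤ R.mean s a)
    {π : Policy S A} (hτ : ∀ τ ∈ (trajLaw P π H s₁).support, cumReward R τ ≤ 1) :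
    Summable fun τ => (trajLaw P π H s₁ τ).toReal * cumReward R τ :=
  Summable.of_nonneg_of_le
    (fun τ => mul_nonneg ENNReal.toReal_nonneg (cumReward_nonneg hR τ))
    (toReal_mul_cumReward_le hτ) (summable_toReal _)

theorem mdp_value_mem_Icc {R : Reward S A F} (hR : ∀ s a, 0 ≤ R.mean s a) (π : Pol)
    (hτ : ∀ τ ∈ (trajLaw P π.1 H s₁).support, cumReward R τ ≤ 1) :
    (mdp H s₁ Pol P R).value π ∈ Set.Icc (0 : ℝ) 1 :=
  ⟨tsum_nonneg fun τ => mul_nonneg ENNReal.toReal_nonneg (cumReward_nonneg hR τ),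
    ((summable_toReal_mul_cumReward hR hτ).tsum_le_tsum (toReal_mul_cumReward_le hτ)
      (summable_toReal _)).trans_eq (tsum_toReal _)⟩

theorem mdp_law_apply (R : Reward S A F) (π : Pol) (o : Obs S A F) :
    (mdp H s₁ Pol P R).law π o = trajLaw P π.1 H s₁ o.1 * R.feedback o.1 o.2 := by
  classical
  obtain ⟨τ, f⟩ := o
  simp only [mdp, PMF.bind_apply, PMF.map_apply]
  rw [tsum_eq_single τ, tsum_eq_single f]
  · simp
  · intro f' hf'
    simp [hf'.symm]
  · intro τ' hτ'
    simp [hτ'.symm]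

/-- For a fixed kernel the trajectory law does not depend on the reward, so law and value are linear
in the reward component. Mixing different kernels would break this, hence one set of models per
kernel. -/
theorem convex_coords_mdp {𝓡 : Set (Reward S A F)} (h_conv : ConvexRewards 𝓡)
    (hR : ∀ R ∈ 𝓡, ∀ s a, 0 ≤ R.mean s a)
    (hτ : ∀ R ∈ 𝓡, ∀ π ∈ Pol, ∀ τ ∈ (trajLaw P π H s₁).support, cumReward R τ ≤ 1) :
    Convex ℝ (coords '' (mdp H s₁ Pol P '' 𝓡)) := by
  rintro _ ⟨_, ⟨R, hR𝓡, rfl⟩, rfl⟩ _ ⟨_, ⟨R', hR'𝓡, rfl⟩, rfl⟩ a b ha hb hab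
  lift a to ℝ≥0 using ha
  lift b to ℝ≥0 using hb
  obtain ⟨R'', hR'', hmean, hfb⟩ := h_conv R hR𝓡 R' hR'𝓡 a b (by exact_mod_cast hab)
  refine ⟨_, ⟨R'', hR'', rfl⟩, Prod.ext ?_ ?_⟩
  · funext π o
    have h1 : ∀ (c : ℝ≥0) (Q : Reward S A F), (c : ℝ≥0∞) * Q.feedback o.1 o.2 ≠ ∞ := fun c Q =>
      ENNReal.mul_ne_top ENNReal.coe_ne_top (PMF.apply_ne_top _ _)
    simp only [coords, mdp_law_apply, hfb, ENNReal.toReal_mul, ENNReal.toReal_add (h1 _ _) (h1 _ _),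
      ENNReal.coe_toReal, Prod.fst_add, Prod.smul_fst, Pi.add_apply, Pi.smul_apply, smul_eq_mul]
    ring
  · funext π
    have hs := summable_toReal_mul_cumReward (hR R hR𝓡) (hτ R hR𝓡 π.1 π.2)
    have hs' := summable_toReal_mul_cumReward (hR R' hR'𝓡) (hτ R' hR'𝓡 π.1 π.2)
    simp only [coords, mdp, cumReward_mix hmean, Prod.snd_add, Prod.smul_snd, Pi.add_apply,
      Pi.smul_apply, smul_eq_mul]
    rw [← tsum_mul_left, ← tsum_mul_left, ← (hs.mul_left _).tsum_add (hs'.mul_left _)]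
    exact tsum_congr fun τ => by ring

end Values

/-! ### Expectations along the interaction -/

theorem tsum_bind_mul {α β : Type*} (p : PMF α) (q : α → PMF β) (g : β → ℝ≥0∞) :
    ∑' b, (p.bind q) b * g b = ∑' a, p a * ∑' b, q a b * g b := by
  simp only [PMF.bind_apply, ← ENNReal.tsum_mul_right, ← ENNReal.tsum_mul_left]
  rw [ENNReal.tsum_comm]
  simp only [mul_assoc]

theorem tsum_map_mul {α β : Type*} (p : PMF α) (f : α → β) (g : β → ℝ≥0∞) :
    ∑' b, (p.map f) b * g b = ∑' a, p a * g (f a) := by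
  rw [← PMF.bind_pure_comp, tsum_bind_mul]
  simp

theorem tsum_mul_le_of_forall_le {α : Type*} (p : PMF α) (g : α → ℝ≥0∞) (C : ℝ≥0∞)
    (h : ∀ a, g a ≤ C) : ∑' a, p a * g a ≤ C :=
  calc ∑' a, p a * g a ≤ ∑' a, p a * C := ENNReal.tsum_le_tsum fun a => mul_le_mul_right (h a) _
    _ = C := by rw [ENNReal.tsum_mul_right, p.tsum_coe, one_mul]

section Interaction

variable {H : ℕ} {s₁ : S} {Pol : Finset (Policy S A)} {𝓡 : Set (Reward S A F)}

/-- The regret of a history, shifted by `1` in every round. -/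
def shiftedRegret (H : ℕ) (s₁ : S) (P : Transition S A) (πstar : Pol)
    (h : List (Round Pol 𝓡)) : ℝ≥0∞ :=
  (h.map fun x => ENNReal.ofReal (1 + (mdp H s₁ Pol P x.1.1).value πstar
    - (mdp H s₁ Pol P x.1.1).value x.2.1)).sum

/-- A potential which grows by at most `C` in every round in expectation grows by at most `t C` in
`t` rounds. -/
theorem tsum_historyLaw_mul_le (P : Transition S A) (alg : Algorithm F Pol)
    (adv : Adversary Pol 𝓡) (πstar : Pol) (L : List (Pol × Obs S A F) → ℝ≥0∞) (C : ℝ≥0∞)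
    (hL : ∀ l, ∀ R ∈ 𝓡, ∑' π, alg l π * (ENNReal.ofReal (1 + (mdp H s₁ Pol P R).value πstar
        - (mdp H s₁ Pol P R).value π)
        + ∑' o, (mdp H s₁ Pol P R).law π o * L (l ++ [(π, o)])) ≤ C + L l) (t : ℕ) :
    ∑' h, historyLaw H s₁ P alg adv t h
      * (shiftedRegret H s₁ P πstar h + L (h.map fun x => x.2)) ≤ t * C + L [] := by
  induction t with
  | zero => simp [historyLaw, shiftedRegret]
  | succ t ih =>
    have key : ∀ h : List (Round Pol 𝓡), ∑' R, adv h R * ∑' π, alg (h.map fun x => x.2) π *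
        ∑' o, (mdp H s₁ Pol P R.1).law π o * (shiftedRegret H s₁ P πstar (h ++ [(R, π, o)])
          + L ((h ++ [(R, π, o)]).map fun x => x.2))
        ≤ C + (shiftedRegret H s₁ P πstar h + L (h.map fun x => x.2)) := by
      intro h
      -- The bound holds for each reward, hence for any random choice of the adversary.
      refine tsum_mul_le_of_forall_le _ _ _ fun R => ?_
      have e : ∀ π : Pol, ∑' o, (mdp H s₁ Pol P R.1).law π o
          * (shiftedRegret H s₁ P πstar (h ++ [(R, π, o)])
            + L ((h ++ [(R, π, o)]).map fun x => x.2))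
          = shiftedRegret H s₁ P πstar h + (ENNReal.ofReal (1 + (mdp H s₁ Pol P R.1).value πstar
              - (mdp H s₁ Pol P R.1).value π)
            + ∑' o, (mdp H s₁ Pol P R.1).law π o * L ((h.map fun x => x.2) ++ [(π, o)])) := by
        intro π
        simp only [shiftedRegret, List.map_append, List.map_cons, List.map_nil, List.sum_append,
          List.sum_cons, List.sum_nil, add_zero, mul_add, ENNReal.tsum_add,
          ENNReal.tsum_mul_right, PMF.tsum_coe, one_mul, add_assoc]
      simp only [e]
      simp only [mul_add (_ : ℝ≥0∞) (shiftedRegret H s₁ P πstar h), ENNReal.tsum_add,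
        ENNReal.tsum_mul_right, PMF.tsum_coe, one_mul]
      calc _ ≤ shiftedRegret H s₁ P πstar h + (C + L (h.map fun x => x.2)) :=
            add_le_add_right (hL _ R.1 R.2) _
        _ = _ := by ring
    simp only [historyLaw, tsum_bind_mul, tsum_map_mul]
    calc _ ≤ ∑' h, historyLaw H s₁ P alg adv t h
            * (C + (shiftedRegret H s₁ P πstar h + L (h.map fun x => x.2))) :=
          ENNReal.tsum_le_tsum fun h => mul_le_mul_right (key h) _
      _ ≤ C + (t * C + L []) := by
          simp only [mul_add (_ : ℝ≥0∞) C, ENNReal.tsum_add, ENNReal.tsum_mul_right, PMF.tsum_coe,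
            one_mul]
          exact add_le_add_right ih _
      _ = _ := by push_cast; ring

theorem length_of_mem_support_historyLaw (P : Transition S A) (alg : Algorithm F Pol)
    (adv : Adversary Pol 𝓡) (t : ℕ) :
    ∀ h ∈ (historyLaw H s₁ P alg adv t).support, h.length = t := by
  induction t with
  | zero => simp [historyLaw]
  | succ t ih =>
    intro h hh
    simp only [historyLaw, PMF.mem_support_bind_iff, PMF.mem_support_map_iff] at hh
    obtain ⟨h', hh', R, _, π, _, o, _, rfl⟩ := hh
    simp [ih h' hh']

theorem shiftedRegret_eq {P : Transition S A}
    (hV : ∀ R ∈ 𝓡, ∀ π, (mdp H s₁ Pol P R).value π ∈ Set.Icc (0 : ℝ) 1) (πstar : Pol)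
    (h : List (Round Pol 𝓡)) :
    shiftedRegret H s₁ P πstar h = ENNReal.ofReal (h.length + regret H s₁ P πstar h) ∧
      0 ≤ h.length + regret H s₁ P πstar h ∧ |regret H s₁ P πstar h| ≤ h.length := by
  induction h with
  | nil => simp [shiftedRegret, regret]
  | cons x h ih =>
    obtain ⟨h1, h2, h3⟩ := ih
    have ha := hV x.1.1 x.1.2 πstar
    have hb := hV x.1.1 x.1.2 x.2.1
    have e1 : regret H s₁ P πstar (x :: h) = ((mdp H s₁ Pol P x.1.1).value πstar
        - (mdp H s₁ Pol P x.1.1).value x.2.1) + regret H s₁ P πstar h := by simp [regret]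
    have e2 : shiftedRegret H s₁ P πstar (x :: h) = ENNReal.ofReal
        (1 + (mdp H s₁ Pol P x.1.1).value πstar - (mdp H s₁ Pol P x.1.1).value x.2.1)
        + shiftedRegret H s₁ P πstar h := by simp [shiftedRegret]
    have h0 : 0 ≤ 1 + (mdp H s₁ Pol P x.1.1).value πstar - (mdp H s₁ Pol P x.1.1).value x.2.1 := by
      linarith [ha.1, hb.2]
    rw [e1, e2, h1, ← ENNReal.ofReal_add h0 h2]
    simp only [List.length_cons, Nat.cast_add, Nat.cast_one]
    refine ⟨by congr 1; ring, by linarith, ?_⟩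
    rw [abs_le] at h3 ⊢
    constructor <;> linarith [ha.1, ha.2, hb.1, hb.2]

/-- Histories in the support have length `T`, so the shift contributes exactly `T` and the regret is
bounded, hence summable. -/
theorem expectedRegret_le {P : Transition S A}
    (hV : ∀ R ∈ 𝓡, ∀ π, (mdp H s₁ Pol P R).value π ∈ Set.Icc (0 : ℝ) 1) (alg : Algorithm F Pol)
    (adv : Adversary Pol 𝓡) (πstar : Pol) (T : ℕ) {C : ℝ} (hC : 0 ≤ C)
    (h : ∑' h, historyLaw H s₁ P alg adv T h * shiftedRegret H s₁ P πstar h ≤ ENNReal.ofReal C) :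
    expectedRegret H s₁ P alg adv πstar T ≤ C - T := by
  let μ := historyLaw H s₁ P alg adv T
  have hlen : ∀ h, μ h = 0 ∨ h.length = T := fun h => by
    by_cases h0 : μ h = 0
    · exact Or.inl h0
    · exact Or.inr (length_of_mem_support_historyLaw P alg adv T h ((PMF.mem_support_iff _ _).2 h0))
  have hsr : Summable fun h => (μ h).toReal * regret H s₁ P πstar h := by
    refine Summable.of_norm_bounded ((summable_toReal μ).mul_right (T : ℝ)) fun h => ?_
    rcases hlen h with h0 | h0
    · simp [h0]
    · rw [norm_mul, Real.norm_of_nonneg ENNReal.toReal_nonneg]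
      refine mul_le_mul_of_nonneg_left ?_ ENNReal.toReal_nonneg
      rw [← h0]
      exact (shiftedRegret_eq hV πstar h).2.2
  have e : ∀ h, μ h * shiftedRegret H s₁ P πstar h
      = ENNReal.ofReal ((μ h).toReal * T + (μ h).toReal * regret H s₁ P πstar h) := fun h => by
    rcases hlen h with h0 | h0
    · simp [h0]
    · rw [← mul_add, ENNReal.ofReal_mul ENNReal.toReal_nonneg,
        ENNReal.ofReal_toReal (PMF.apply_ne_top _ _), ← h0, (shiftedRegret_eq hV πstar h).1]
  have hnn : ∀ h, 0 ≤ (μ h).toReal * T + (μ h).toReal * regret H s₁ P πstar h := fun h => by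
    rcases hlen h with h0 | h0
    · simp [h0]
    · rw [← mul_add, ← h0]
      exact mul_nonneg ENNReal.toReal_nonneg (shiftedRegret_eq hV πstar h).2.1
  have hsT := (summable_toReal μ).mul_right (T : ℝ)
  rw [tsum_congr e, ← ENNReal.ofReal_tsum_of_nonneg hnn (hsT.add hsr),
    ENNReal.ofReal_le_ofReal_iff hC, hsT.tsum_add hsr, tsum_mul_right, tsum_toReal, one_mul] at h
  exact le_sub_iff_add_le'.2 h

end Interaction

end HybridDEC

/-! ### The algorithm and its regret bound -/

open HybridDEC in
theorem mainTheorem6 {S A F : Type*} (H : ℕ) (s₁ : S)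
    (Pol : Finset (HybridDEC.Policy S A)) (hPol : Pol.Nonempty)
    (𝓟 : Finset (HybridDEC.Transition S A))
    (𝓡 : Set (HybridDEC.Reward S A F))
    (h_conv : HybridDEC.ConvexRewards 𝓡)
    (h_range : ∀ R ∈ 𝓡, ∀ s a, R.mean s a ∈ Set.Icc (0 : ℝ) 1)
    (h_total : ∀ P ∈ 𝓟, ∀ R ∈ 𝓡, ∀ π ∈ Pol, ∀ τ ∈ (HybridDEC.trajLaw P π H s₁).support,
      HybridDEC.cumReward R τ ≤ 1)
    (T : ℕ) (η : ℝ) (hη : 0 < η) :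
    ∃ alg : HybridDEC.Algorithm F Pol,
      ∀ P ∈ 𝓟, ∀ (πstar : Pol) (adv : HybridDEC.Adversary Pol 𝓡),
        ((HybridDEC.expectedRegret H s₁ P alg adv πstar T : ℝ) : EReal) ≤
          ((Real.log (Pol.card * 𝓟.card) / η : ℝ) : EReal)
            + ((T : ℝ) : EReal) * HybridDEC.DEC η (HybridDEC.mdpClass H s₁ Pol 𝓟 𝓡) := by
  classical
  have : Nonempty Pol := hPol.to_subtype
  rcases 𝓟.eq_empty_or_nonempty with h𝓟 | h𝓟
  · subst h𝓟
    exact ⟨fun _ => PMF.pure (Classical.arbitrary Pol), fun P hP => by simp at hP⟩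
  -- With no rewards there is no adversary, as it must output a distribution on `𝓡`.
  rcases 𝓡.eq_empty_or_nonempty with h𝓡 | h𝓡
  · subst h𝓡
    refine ⟨fun _ => PMF.pure (Classical.arbitrary Pol), fun P _ _ adv => ?_⟩
    obtain ⟨R, _⟩ := (adv []).support_nonempty
    exact R.2.elim
  have : Nonempty 𝓟 := h𝓟.to_subtype
  let Φ := Pol × 𝓟
  let K : Φ → Set (Model Pol (Obs S A F)) := fun φ => mdp H s₁ Pol φ.2.1 '' 𝓡
  have hmean : ∀ R ∈ 𝓡, ∀ s a, 0 ≤ R.mean s a := fun R hR s a => (h_range R hR s a).1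
  have hV : ∀ P ∈ 𝓟, ∀ R ∈ 𝓡, ∀ π, (mdp H s₁ Pol P R).value π ∈ Set.Icc (0 : ℝ) 1 :=
    fun P hP R hR π => mdp_value_mem_Icc (hmean R hR) π (h_total P hP R hR π.1 π.2)
  set D := DEC η (mdpClass H s₁ Pol 𝓟 𝓡) with hD
  have hD0 : 0 ≤ D := DEC_nonneg η (by
    obtain ⟨P, hP⟩ := h𝓟
    obtain ⟨R, hR⟩ := h𝓡
    exact ⟨_, P, hP, R, hR, rfl⟩)
  have hD1 : D ≤ 1 := DEC_le_one η (by
    rintro _ ⟨P, hP, R, hR, rfl⟩ π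
    exact hV P hP R hR π)
  have hDc : D = (D.toReal : EReal) := (EReal.coe_toReal
    (fun h => by rw [h] at hD1; exact absurd hD1 (by decide))
    (fun h => by rw [h] at hD0; exact absurd hD0 (by decide))).symm
  have hc0 : 0 ≤ D.toReal := EReal.toReal_nonneg hD0
  choose! strat hstrat hle using fun (ρ : Φ → ℝ) (hρ : ρ ∈ stdSimplex ℝ Φ) =>
    exists_strategy_negLog hη hc0 hDc.le (fun φ : Φ => φ.1) K (fun φ => h𝓡.image _)
      (fun φ => convex_coords_mdp h_conv hmean (h_total φ.2.1 φ.2.2))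
      (fun φ => by rintro _ ⟨R, hR, rfl⟩; exact ⟨φ.2.1, φ.2.2, R, hR, rfl⟩)
      (fun φ => by rintro _ ⟨R, hR, rfl⟩; exact hV φ.2.1 φ.2.2 R hR) hρ
  -- Start uniform and apply the minimax update after each round; only the learner's own policies
  -- and observations enter.
  let belief : List (Pol × Obs S A F) → Φ → ℝ :=
    List.foldl (fun ρ x => (strat ρ).2 x.1 x.2) fun _ => (Fintype.card Φ : ℝ)⁻¹
  have hbelief : ∀ l, belief l ∈ stdSimplex ℝ Φ := fun l => by
    induction l using List.reverseRecOn with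
    | nil => exact ⟨fun _ => by simp [belief], by simp [belief, -Fintype.card_prod]⟩
    | append_singleton l x ih =>
      simp only [belief, List.foldl_append, List.foldl_cons, List.foldl_nil]
      exact belief_mem (hstrat _ ih) _ _
  let alg : Algorithm F Pol := fun l => simplexPMF (strat (belief l)).1 (hstrat _ (hbelief l)).1
  refine ⟨alg, fun P hP πstar adv => ?_⟩
  let φ : Φ := (πstar, ⟨P, hP⟩)
  have hpot := tsum_historyLaw_mul_le (H := H) (s₁ := s₁) P alg adv πstar
    (fun l => ENNReal.ofReal η⁻¹ * negLog (belief l φ)) (ENNReal.ofReal (1 + D.toReal))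
    (fun l R hR => by
      have := hle (belief l) (hbelief l) φ _ ⟨R, hR, rfl⟩
      rw [tsum_fintype]
      refine le_trans (le_of_eq (Finset.sum_congr rfl fun π _ => ?_)) this
      simp only [belief, List.foldl_append, List.foldl_cons, List.foldl_nil]
      rw [← ENNReal.tsum_mul_left]
      congr 2
      exact tsum_congr fun o => mul_left_comm _ _ _) T
  have hcard : (1 : ℝ) ≤ Fintype.card Φ := by exact_mod_cast Fintype.card_pos
  have hlog : 0 ≤ Real.log (Fintype.card Φ) := Real.log_nonneg hcard
  have hinit : ENNReal.ofReal η⁻¹ * negLog (belief [] φ)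
      ≤ ENNReal.ofReal (Real.log (Fintype.card Φ) / η) := by
    rw [div_eq_inv_mul, ENNReal.ofReal_mul (inv_nonneg.2 hη.le)]
    refine mul_le_mul_right ((negLog_le (u := (Fintype.card Φ : ℝ)⁻¹) (by positivity)
      (inv_le_one_of_one_le₀ hcard)).trans_eq ?_) _
    rw [Real.log_inv, neg_neg]
  have hreg := expectedRegret_le (hV P hP) alg adv πstar T
    (C := T * (1 + D.toReal) + Real.log (Fintype.card Φ) / η) (by positivity) (by
      -- The potential after the last round is nonnegative and is dropped.
      refine (ENNReal.tsum_le_tsum fun h => mul_le_mul_right le_self_add _).trans (hpot.trans ?_)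
      rw [ENNReal.ofReal_add (p := T * (1 + D.toReal)) (by positivity) (by positivity),
        ENNReal.ofReal_mul (by positivity), ENNReal.ofReal_natCast]
      exact add_le_add_right hinit _)
  rw [hDc, ← EReal.coe_mul, ← EReal.coe_add, EReal.coe_le_coe_iff]
  have hcardΦ : (Fintype.card Φ : ℝ) = Pol.card * 𝓟.card := by simp [Φ]
  rw [hcardΦ] at hreg
  linarith

end
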